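/- Let $m\ge \tilde m\ge 0$ and $n\ge 0$ be integers with $m\ge 1$. Let $\alpha_s=(\cos\varphi_s,\sin\varphi_s)\in\mathbb{R}^2$, $s=0,\dots,n+1$, be pairwise non-collinear vectors with multiplicities $m_0=m$, $m_{n+1}=\tilde m$, $m_1=\dots=m_n=1$, and put $z_s=e^{2i\varphi_s}$, $i=\sqrt{-1}$. Suppose that $\alpha_0$ and $\alpha_{n+1}$ are orthogonal, that the arrangement of the lines spanned by the $\alpha_s$ is symmetric under the reflection about $\alpha_0$, that $$\sum_{\substack{0\le s\le n+1\\ s\ne j}} m_s\,\frac{z_s+z_j}{z_s-z_j}=0\qquad (j=1,\dots,n),$$ and that $z_0=1$. Consider the operator $$L=-\partial_\varphi^2+\frac{m(m+1)}{\sin^2\varphi}+\frac{\tilde m(\tilde m+1)}{\cos^2\varphi}+\sum_{j=1}^n\frac{2}{\sin^2(\varphi-\varphi_j)}$$ and the function $$Q(\varphi)=e^{-in\varphi}\prod_{j=1}^n\bigl(e^{2i\varphi}-e^{2i\varphi_j}\bigr).$$ Define integers $k_1,\dots,k_m$ by $k_m=\tilde m+m+n$ and, for $j<m$, $k_j=j$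 if $j\le m-\tilde m$, and $k_{m-\tilde m+l}=m-\tilde m+2l$ for $1\le l\le\tilde m-1$. Let $\chi_j(\varphi)=\sin(k_j\varphi)$, and let $W=W[\chi_1,\dots,\chi_m]=\det\bigl(\partial_\varphi^{\,l-1}\chi_j\bigr)_{l,j=1}^m$ be their Wronskian. Then $W$ does not vanish at any real point where the potential of $L$ is regular, and at these points $L$ is the Darboux–Crum transform of the free operator $-\partial_\varphi^2$ by $\chi_1,\dots,\chi_m$: $$L=-\partial_\varphi^2-2\,\partial_\varphi^2\log W[\chi_1,\dots,\chi_m].$$ (If $\tilde m=0$, the term with $\cos^2\varphi$ is absent.) Moreover, $$Q(\varphi)=\nu\,(\cos\varphi)^{-\frac{\tilde m(\tilde m+1)}2}(\sin\varphi)^{-\frac{m(m+1)}2}\,W[\chi_1,\dots,\chi_m],$$ where $$\nu=2^{-\frac{\tilde m(\tilde m+1)}2-\frac{m(m-1)}2}\,(-1)^{\frac{m(m-1)}2}\prod_{1\le q<p\le m}(k_p-k_q)^{-1}.$$ -/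

import Mathlib

noncomputable section

namespace DarbouxCrum

/-- The unit vector `(cos θ, sin θ)` of the Euclidean plane. -/
def dirVec (θ : ℝ) : EuclideanSpace ℝ (Fin 2) := !₂[Real.cos θ, Real.sin θ]

/-- The complex coordinate `z = exp (2 i θ)` of the line through `(cos θ, sin θ)`. -/
def zCoord (θ : ℝ) : ℂ := Complex.exp (2 * Complex.I * (θ : ℂ))

/-- The multiplicities of the vectors `α₀, …, α_{n+1}`: the vector `α₀` has multiplicity `m`,
the vector `α_{n+1}` has multiplicity `m'`, all the other vectors have multiplicity `1`. -/
def mult (m m' n : ℕ) (i : Fin (n + 2)) : ℕ :=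
  if i = 0 then m else if i = Fin.last (n + 1) then m' else 1

/-- The index `j ∈ {1, …, n}` of a vector of multiplicity one, as an index in `{0, …, n + 1}`. -/
def inner1 {n : ℕ} (j : Fin n) : Fin (n + 2) := j.succ.castSucc

/-- The vectors `α_i = (cos φ_i, sin φ_i)`, `0 ≤ i ≤ n + 1`, with multiplicities `m` (for `i = 0`),
`m'` (for `i = n + 1`) and `1` (for `1 ≤ i ≤ n`) form the configuration `(m, m', 1ⁿ)`:
the vectors are pairwise non-collinear, `α₀` and `α_{n+1}` are orthogonal, the arrangement of
lines is symmetric under the reflection about `α₀`, and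
`∑_{i ≠ j} m_i (z_i + z_j) / (z_i - z_j) = 0` for `j = 1, …, n`. -/
structure IsConfiguration (m m' n : ℕ) (φ : Fin (n + 2) → ℝ) : Prop where
  noncollinear : ∀ i j, i ≠ j → LinearIndependent ℝ ![dirVec (φ i), dirVec (φ j)]
  orthogonal : inner ℝ (dirVec (φ 0)) (dirVec (φ (Fin.last (n + 1)))) = 0
  symmetric : ∀ i, ∃ j,
    Submodule.span ℝ {(Submodule.span ℝ {dirVec (φ 0)}).reflection (dirVec (φ i))} =
      Submodule.span ℝ {dirVec (φ j)}
  critical : ∀ j : Fin n,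
    ∑ i ∈ Finset.univ.erase (inner1 j),
      (mult m m' n i : ℂ) * (zCoord (φ i) + zCoord (φ (inner1 j))) /
        (zCoord (φ i) - zCoord (φ (inner1 j))) = 0

/-- The Sturm–Liouville operator `-∂² + V`. -/
def sturmLiouville (V : ℝ → ℝ) (f : ℝ → ℂ) (θ : ℝ) : ℂ :=
  -(deriv (deriv f) θ) + (V θ : ℂ) * f θ

/-- The potential
`m(m+1)/sin² θ + m'(m'+1)/cos² θ + ∑_{j=1}^n 2/sin² (θ - φ_j)`. -/
def angularPotential (m m' n : ℕ) (φ : Fin (n + 2) → ℝ) (θ : ℝ) : ℝ :=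
  (m : ℝ) * ((m : ℝ) + 1) / Real.sin θ ^ 2 + (m' : ℝ) * ((m' : ℝ) + 1) / Real.cos θ ^ 2 +
    ∑ j : Fin n, 2 / Real.sin (θ - φ (inner1 j)) ^ 2

/-- The points at which the potential `angularPotential` is regular. A term with the vanishing
coefficient `m(m+1)` or `m'(m'+1)` is absent and creates no singularity. -/
def regularSet (m m' n : ℕ) (φ : Fin (n + 2) → ℝ) : Set ℝ :=
  {θ | (m ≠ 0 → Real.sin θ ≠ 0) ∧ (m' ≠ 0 → Real.cos θ ≠ 0) ∧
    ∀ j : Fin n, Real.sin (θ - φ (inner1 j)) ≠ 0}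

/-- The Wronskian `W[χ₁, …, χ_m] = det (∂^{i-1} χ_j)`. -/
def wronskian {m : ℕ} (χ : Fin m → ℝ → ℝ) (θ : ℝ) : ℝ :=
  Matrix.det (Matrix.of fun i j : Fin m => iteratedDeriv (i : ℕ) (χ j) θ)

/-- The Darboux–Crum transform `-∂² + V - 2 ∂² log W[χ₁, …, χ_m]` of the operator `-∂² + V`.
Here `Real.log x = log |x|`, so that `(log W)' = W' / W` wherever `W ≠ 0`. -/
def darbouxCrum {m : ℕ} (V : ℝ → ℝ) (χ : Fin m → ℝ → ℝ) : (ℝ → ℂ) → ℝ → ℂ :=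
  sturmLiouville fun θ => V θ - 2 * deriv (deriv fun t => Real.log (wronskian χ t)) θ

/-- The integers `k_j`, `1 ≤ j ≤ m`: `k_m = m' + m + n`, and for `j < m`,
`k_j = j` if `j ≤ m - m'`, `k_j = (m - m') + 2 (j - (m - m'))` if `j > m - m'`. -/
def param (m m' n j : ℕ) : ℕ :=
  if j = m then m' + m + n
  else if j ≤ m - m' then j
  else (m - m') + 2 * (j - (m - m'))

/-- The functions `χ_j(θ) = sin (k_j θ)`, `1 ≤ j ≤ m`; the index `j : Fin m` starts at zero. -/
def chi (m m' n : ℕ) (j : Fin m) (θ : ℝ) : ℝ :=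
  Real.sin ((param m m' n ((j : ℕ) + 1) : ℝ) * θ)

/-- `Q(θ) = P(w) w^{-n/2}` at `w = exp (2 i θ)`, where `P(w) = ∏_{j=1}^n (w - z_j)`. -/
def Q (n : ℕ) (φ : Fin (n + 2) → ℝ) (θ : ℝ) : ℂ :=
  (∏ j : Fin n, (zCoord θ - zCoord (φ (inner1 j)))) *
    Complex.exp (-(Complex.I * (n : ℂ) * (θ : ℂ)))

/-- The constant
`2^{-m'(m'+1)/2 - m(m-1)/2} (-1)^{m(m-1)/2} ∏_{p > q} (k_p - k_q)⁻¹`. -/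
def nu (m m' n : ℕ) : ℝ :=
  (2 : ℝ)⁻¹ ^ (m' * (m' + 1) / 2 + m * (m - 1) / 2) * (-1 : ℝ) ^ (m * (m - 1) / 2) *
    ∏ p ∈ Finset.Icc 1 m, ∏ q ∈ Finset.Ico 1 p,
      ((param m m' n p : ℝ) - (param m m' n q : ℝ))⁻¹

end DarbouxCrum

end

/-! Write `s = m - m'`. Subtracting from `∂` the logarithmic derivatives of `sin^l cos^{(l-s)₊}`, `l
= 1, 2, …`, gives first order operators whose iterates replace the rows `∂^l χ_j` of the Wronskian
without changing the determinant. On `sin (kθ)` the iterates are `sin^l cos^{(l-s)₊} R_l (cos θ)`,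
where `R_l` comes from the Chebyshev polynomial `T_k` by differentiations, followed by divisions by
the variable from level `s` on. The degree of `R_l` is at most `k - l - (l-s)₊`, and `k_j = j +
(j-s)₊` for `j < m`, so the new matrix is triangular. All its diagonal entries except the last are a
constant times powers of sine and cosine; the last one also carries a polynomial `R_m` of degree `n`
(`wronskian_chi_eq_prod`).

On the other side, the equilibrium conditions make `∏ (X - z_j)` satisfy a Heine–Stieltjes equation
(`rootPoly_ode`). By the reflection symmetry `Q(θ) = q(cos θ)`, and the equation becomes a two-term
recurrence for the coefficients of `q` (`cosPoly_coeff_recurrence`). `R_m` obeys the same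
recurrence, inherited from the Chebyshev equation (`ladder_coeff_recurrence`). A solution vanishing
above index `n` is fixed by its coefficient of index `n`, so `R_m` and `q` are proportional, and
comparing top coefficients produces `ν`.

Finally `|Q| = ∏ 2 |sin (θ - φ_j)|` gives the nonvanishing of `W` and an explicit `log |W|`, whose
second derivative is the potential. -/

noncomputable section

namespace DarbouxCrum

open Polynomial
open scoped ContDiff

/-! ### Ladder polynomials built from Chebyshev polynomials -/

/-- The polynomials `R_l` with
`D_l ⋯ D_1 (sin (k θ)) = sin^{l+1} θ cos^{l+1-s} θ R_{l+1} (cos θ)`, where `D_l` is the first order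
operator `∂ - l cot θ + (l - s) tan θ` (truncated subtraction). -/
def ladder (k s : ℕ) : ℕ → ℝ[X]
  -- Level `0` stands for `-cos (kθ) / k`, an antiderivative of `sin (kθ)`, which therefore sits at
  -- level `1`.
  | 0 => C (-(k : ℝ)⁻¹) * Chebyshev.T ℝ k
  | l + 1 => if l < s then -derivative (ladder k s l) else -(derivative (ladder k s l)).divX

lemma ladder_succ_of_lt {k s l : ℕ} (h : l < s) :
    ladder k s (l + 1) = -derivative (ladder k s l) := by
  simp [ladder, h]

lemma ladder_succ_of_le {k s l : ℕ} (h : s ≤ l) :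
    ladder k s (l + 1) = -(derivative (ladder k s l)).divX := by
  simp [ladder, h.not_gt]

lemma coeff_ladder_succ_of_lt {k s l : ℕ} (h : l < s) (i : ℕ) :
    (ladder k s (l + 1)).coeff i = -((i + 1 : ℝ) * (ladder k s l).coeff (i + 1)) := by
  rw [ladder_succ_of_lt h, coeff_neg, coeff_derivative]; ring

lemma coeff_ladder_succ_of_le {k s l : ℕ} (h : s ≤ l) (i : ℕ) :
    (ladder k s (l + 1)).coeff i = -((i + 2 : ℝ) * (ladder k s l).coeff (i + 2)) := by
  rw [ladder_succ_of_le h, coeff_neg, coeff_divX, coeff_derivative]; push_cast; ring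

lemma chebyshevT_coeff_of_odd {R : Type*} [CommRing R] (n : ℕ) :
    ∀ i, Odd (i + n) → (Chebyshev.T R n).coeff i = 0 := by
  induction n using Nat.twoStepInduction with
  | zero =>
    intro i hi
    have : i ≠ 0 := by rintro rfl; simp at hi
    simp [coeff_one, this]
  | one =>
    intro i hi
    have : 1 ≠ i := by rintro rfl; exact absurd hi (by decide)
    simp [coeff_X, this]
  | more n h0 h1 =>
    intro i hi
    have e : (Chebyshev.T R ((n + 2 : ℕ) : ℤ)) =
        C 2 * (X * Chebyshev.T R ((n + 1 : ℕ) : ℤ)) - Chebyshev.T R (n : ℤ) := by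
      push_cast
      rw [Chebyshev.T_add_two, C_ofNat]; ring
    rw [e, coeff_sub, coeff_C_mul, h0 i (by grind)]
    rcases i with _ | i
    · simp
    · rw [coeff_X_mul, h1 i (by grind)]; simp

lemma chebyshevT_coeff_recurrence {R : Type*} [CommRing R] (k i : ℕ) :
    ((i : R) + 2) * (i + 1) * (Chebyshev.T R k).coeff (i + 2) +
      ((k : R) ^ 2 - i ^ 2) * (Chebyshev.T R k).coeff i = 0 := by
  have h := Chebyshev.one_sub_X_sq_mul_derivative_derivative_T_eq_poly_in_T (R := R) k
  have h' := congr_arg (fun p => p.coeff i) h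
  simp only [Function.iterate_succ, Function.iterate_zero, Function.comp_apply, id, sub_mul,
    one_mul, coeff_sub, Int.cast_natCast] at h'
  rw [← Nat.cast_pow, ← C_eq_natCast, coeff_C_mul] at h'
  rcases i with _ | _ | i
  · simp [coeff_derivative] at h' ⊢
    linear_combination h'
  · simp [coeff_X_pow_mul', coeff_derivative] at h' ⊢
    linear_combination h'
  · rw [coeff_X_mul, coeff_X_pow_mul] at h'
    simp only [coeff_derivative] at h'
    push_cast at h' ⊢
    linear_combination h'

lemma chebyshevT_coeff_eq_zero {R : Type*} [CommRing R] [IsDomain R] [NeZero (2 : R)] {k i : ℕ}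
    (h : k < i) : (Chebyshev.T R k).coeff i = 0 := by
  apply coeff_eq_zero_of_natDegree_lt
  rwa [Chebyshev.natDegree_T, Int.natAbs_natCast]

lemma chebyshevT_coeff_self {R : Type*} [CommRing R] [IsDomain R] [NeZero (2 : R)] (k : ℕ) :
    (Chebyshev.T R k).coeff k = 2 ^ (k - 1) := by
  have := Chebyshev.leadingCoeff_T R k
  rwa [leadingCoeff, Chebyshev.natDegree_T, Int.natAbs_natCast] at this

/-- Each step lowers exponents by `1` or `2`, so the parity of `T_k` survives. This guarantees that
`divX` discards nothing. -/
lemma ladder_coeff_of_odd (k s l : ℕ) :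
    ∀ i, Odd (i + l + (l - s) + k) → (ladder k s l).coeff i = 0 := by
  induction l with
  | zero =>
    intro i hi
    rw [ladder, coeff_C_mul, chebyshevT_coeff_of_odd k i (by simpa using hi), mul_zero]
  | succ l ih =>
    intro i hi
    rcases lt_or_ge l s with h | h
    · rw [coeff_ladder_succ_of_lt h, ih (i + 1) (by grind)]; simp
    · rw [coeff_ladder_succ_of_le h, ih (i + 2) (by grind)]; simp

/-- This degree bound is the source of the triangularity of the transformed Wronskian matrix. -/
lemma ladder_coeff_of_lt (k s l : ℕ) :
    ∀ i, k < i + l + (l - s) → (ladder k s l).coeff i = 0 := by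
  induction l with
  | zero =>
    intro i hi
    rw [ladder, coeff_C_mul, chebyshevT_coeff_eq_zero (by simpa using hi), mul_zero]
  | succ l ih =>
    intro i hi
    rcases lt_or_ge l s with h | h
    · rw [coeff_ladder_succ_of_lt h, ih (i + 1) (by omega)]; simp
    · rw [coeff_ladder_succ_of_le h, ih (i + 2) (by omega)]; simp

/-- Level `0` is the Chebyshev differential equation; a ladder step shifts the coefficients and
rescales them by linear factors, which preserves the shape of the recurrence. -/
lemma ladder_coeff_recurrence (k s l : ℕ) :
    ∀ i : ℕ, ((i : ℝ) + 2) * (i + 1 + 2 * (l - s : ℕ)) * (ladder k s l).coeff (i + 2) +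
      ((k : ℝ) ^ 2 - (i + l + (l - s : ℕ)) ^ 2) * (ladder k s l).coeff i = 0 := by
  induction l with
  | zero =>
    intro i
    rw [ladder, coeff_C_mul, coeff_C_mul]
    have := chebyshevT_coeff_recurrence (R := ℝ) k i
    simp only [zero_tsub, Nat.cast_zero]
    linear_combination (-(k : ℝ)⁻¹) * this
  | succ l ih =>
    intro i
    rcases lt_or_ge l s with h | h
    · have := ih (i + 1)
      rw [coeff_ladder_succ_of_lt h, coeff_ladder_succ_of_lt h]
      rw [show l - s = 0 by omega] at this
      rw [show l + 1 - s = 0 by omega]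
      push_cast at this ⊢
      linear_combination (-(i : ℝ) - 1) * this
    · have := ih (i + 2)
      rw [coeff_ladder_succ_of_le h, coeff_ladder_succ_of_le h]
      rw [show l + 1 - s = (l - s) + 1 by omega]
      push_cast at this ⊢
      linear_combination (-(i : ℝ) - 2) * this

/-- Every step multiplies the top coefficient by minus the current degree. At level `0` this cancels
`-1/k`; at level `q` the degree is `k - (q + (q - s))`, which becomes the factor `k_p - k_q` of `ν`.
-/
lemma ladder_coeff_top {k s : ℕ} (hk : k ≠ 0) (l : ℕ) :
    ∀ i, i + (l + 1) + (l + 1 - s) = k → (ladder k s (l + 1)).coeff i =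
      (-1) ^ l * 2 ^ (k - 1) * ∏ q ∈ Finset.Ico 1 (l + 1), ((k : ℝ) - (q + (q - s) : ℕ)) := by
  induction l with
  | zero =>
    intro i hi
    rcases lt_or_ge 0 s with h | h
    · rw [coeff_ladder_succ_of_lt h]
      obtain rfl : k = i + 1 := by omega
      rw [ladder, coeff_C_mul, chebyshevT_coeff_self]
      have : ((i : ℝ) + 1) ≠ 0 := by positivity
      simp; field_simp
    · rw [coeff_ladder_succ_of_le h]
      obtain rfl : k = i + 2 := by omega
      rw [ladder, coeff_C_mul, chebyshevT_coeff_self]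
      have : ((i : ℝ) + 2) ≠ 0 := by positivity
      simp; field_simp
  | succ l ih =>
    intro i hi
    rw [Finset.prod_Ico_succ_top (by omega), pow_succ]
    rcases lt_or_ge (l + 1) s with h | h
    · rw [coeff_ladder_succ_of_lt h, ih (i + 1) (by omega)]
      have : (k : ℝ) - (l + 1 + (l + 1 - s) : ℕ) = i + 1 := by
        rw [show k = (i + 1) + (l + 1 + (l + 1 - s)) by omega]; push_cast; ring
      rw [this]; ring
    · rw [coeff_ladder_succ_of_le h, ih (i + 2) (by omega)]
      have : (k : ℝ) - (l + 1 + (l + 1 - s) : ℕ) = i + 2 := by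
        rw [show k = (i + 2) + (l + 1 + (l + 1 - s)) by omega]; push_cast; ring
      rw [this]; ring

lemma ladder_eq_zero {k s l : ℕ} (h : k < l + (l - s)) : ladder k s l = 0 := by
  ext i
  rw [ladder_coeff_of_lt k s l i (by omega), coeff_zero]

lemma ladder_eq_C {k s l : ℕ} (h : l + (l - s) = k) :
    ladder k s l = C ((ladder k s l).coeff 0) := by
  ext i
  rcases i with _ | i
  · simp
  · rw [ladder_coeff_of_lt k s l _ (by omega), coeff_C_succ]

/-! ### Action of the first order operators on `sin (kθ)` -/

/-- The intertwined functions `sin^l θ cos^{l-s} θ R_l (cos θ)`. -/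
def ladderFun (k s l : ℕ) (θ : ℝ) : ℝ :=
  Real.sin θ ^ l * Real.cos θ ^ (l - s) * (ladder k s l).eval (Real.cos θ)

/-- The logarithmic derivative of `sin^l θ cos^{l-s} θ`. -/
def ladderLogDeriv (s l : ℕ) (θ : ℝ) : ℝ :=
  l * (Real.cos θ / Real.sin θ) - (l - s : ℕ) * (Real.sin θ / Real.cos θ)

/-- The constant term lost by `divX` is zero: by degree if `k ≤ s`, by parity if `k + s` is even. -/
lemma X_mul_ladder_succ {k s l : ℕ} (h : s ≤ l) (hk : k ≤ s ∨ Even (k + s)) :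
    X * ladder k s (l + 1) = -derivative (ladder k s l) := by
  have h0 : (derivative (ladder k s l)).coeff 0 = 0 := by
    rw [coeff_derivative]
    rcases hk with hk | hk
    · rw [ladder_coeff_of_lt k s l _ (by omega), zero_mul]
    · rw [ladder_coeff_of_odd k s l _ (by grind), zero_mul]
  have := divX_mul_X_add (derivative (ladder k s l))
  rw [h0, C_0, add_zero] at this
  rw [ladder_succ_of_le h, mul_neg, mul_comm, this]

lemma hasDerivAt_ladderFun {k s l : ℕ} (hk : k ≤ s ∨ Even (k + s)) {θ : ℝ}
    (hs : Real.sin θ ≠ 0) (hc : s < l → Real.cos θ ≠ 0) :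
    HasDerivAt (ladderFun k s l)
      (ladderFun k s (l + 1) θ + ladderLogDeriv s l θ * ladderFun k s l θ) θ := by
  have hR : HasDerivAt (fun t => (ladder k s l).eval (Real.cos t))
      ((derivative (ladder k s l)).eval (Real.cos θ) * (-Real.sin θ)) θ :=
    ((ladder k s l).hasDerivAt _).comp θ (Real.hasDerivAt_cos θ)
  have h := (((Real.hasDerivAt_sin θ).fun_pow l).mul ((Real.hasDerivAt_cos θ).fun_pow (l - s))).mul hR
  refine HasDerivAt.congr_deriv h ?_
  have e1 : (l : ℝ) * Real.sin θ ^ (l - 1) * Real.cos θ =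
      l * (Real.cos θ / Real.sin θ) * Real.sin θ ^ l := by
    rcases l with _ | l
    · simp
    · rw [Nat.add_sub_cancel, pow_succ]; field_simp
  have e2 : ((l - s : ℕ) : ℝ) * Real.cos θ ^ (l - s - 1) * (-Real.sin θ) =
      -((l - s : ℕ) * (Real.sin θ / Real.cos θ) * Real.cos θ ^ (l - s)) := by
    rcases Nat.eq_zero_or_pos (l - s) with h0 | h0
    · simp [h0]
    · have := hc (by omega)
      obtain ⟨b, hb⟩ : ∃ b, l - s = b + 1 := ⟨l - s - 1, by omega⟩
      rw [hb, Nat.add_sub_cancel, pow_succ]; field_simp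
  have e3 : ladderFun k s (l + 1) θ = Real.sin θ ^ l * Real.cos θ ^ (l - s) *
      ((derivative (ladder k s l)).eval (Real.cos θ) * (-Real.sin θ)) := by
    unfold ladderFun
    rcases lt_or_ge l s with h | h
    · rw [ladder_succ_of_lt h, show l + 1 - s = l - s by omega, eval_neg]; ring
    · have := congr_arg (eval (Real.cos θ)) (X_mul_ladder_succ h hk)
      rw [eval_mul, eval_X, eval_neg] at this
      rw [show l + 1 - s = l - s + 1 by omega]
      linear_combination Real.sin θ ^ (l + 1) * Real.cos θ ^ (l - s) * this
  rw [e3, e1, e2]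
  simp only [ladderFun, ladderLogDeriv, Pi.mul_apply]
  ring

lemma ladderFun_one {k s : ℕ} (hk : k ≤ s ∨ Even (k + s)) (hk0 : k ≠ 0) (θ : ℝ) :
    ladderFun k s 1 θ = Real.sin (k * θ) := by
  have hU := Chebyshev.U_real_cos θ ((k : ℤ) - 1)
  push_cast at hU
  rw [sub_add_cancel] at hU
  have hd : derivative (ladder k s 0) = -Chebyshev.U ℝ ((k : ℤ) - 1) := by
    rw [ladder, derivative_C_mul, Chebyshev.T_derivative_eq_U, ← C_eq_intCast, ← mul_assoc, ← C_mul]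
    rw [Int.cast_natCast, neg_mul, inv_mul_cancel₀ (by exact_mod_cast hk0)]; simp
  rw [← hU]
  rcases lt_or_ge 0 s with h | h
  · rw [ladderFun, ladder_succ_of_lt h, hd, show 0 + 1 - s = 0 by omega]
    simp only [neg_neg, pow_zero, pow_one]; ring
  · have := congr_arg (eval (Real.cos θ)) (X_mul_ladder_succ h hk)
    rw [eval_mul, eval_X, hd, neg_neg] at this
    rw [← this, ladderFun, show 0 + 1 - s = 1 by omega]
    ring

/-! ### Triangularisation of the Wronskian -/

/-- The coefficients expressing `∂^l` through the operators `D_i ⋯ D_1`, `i ≤ l`, where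
`D_i = ∂ - p_{i-1}`. -/
def derivCoeff (p : ℕ → ℝ → ℝ) : ℕ → ℕ → ℝ → ℝ
  | 0, i => fun _ => if i = 0 then 1 else 0
  | l + 1, 0 => fun θ => deriv (derivCoeff p l 0) θ + p 0 θ * derivCoeff p l 0 θ
  | l + 1, i + 1 => fun θ => deriv (derivCoeff p l (i + 1)) θ +
      p (i + 1) θ * derivCoeff p l (i + 1) θ + derivCoeff p l i θ

lemma contDiffOn_derivCoeff {p : ℕ → ℝ → ℝ} {U : Set ℝ} (hU : IsOpen U)
    (hp : ∀ i, ContDiffOn ℝ ∞ (p i) U) (l : ℕ) : ∀ i, ContDiffOn ℝ ∞ (derivCoeff p l i) U := by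
  induction l with
  | zero => intro i; exact contDiffOn_const
  | succ l ih =>
    have hd (i) : ContDiffOn ℝ ∞ (deriv (derivCoeff p l i)) U :=
      ((contDiffOn_infty_iff_deriv_of_isOpen hU).1 (ih i)).2
    rintro (_ | i)
    · exact (hd 0).add ((hp 0).mul (ih 0))
    · exact ((hd _).add ((hp _).mul (ih _))).add (ih i)

lemma derivCoeff_of_lt {p : ℕ → ℝ → ℝ} (l : ℕ) : ∀ i, l < i → derivCoeff p l i = fun _ => 0 := by
  induction l with
  | zero => intro i hi; funext θ; simp [derivCoeff, hi.ne']
  | succ l ih =>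
    rintro (_ | i) hi
    · omega
    · funext θ
      simp [derivCoeff, ih (i + 1) (by omega), ih i (by omega)]

lemma derivCoeff_self {p : ℕ → ℝ → ℝ} (l : ℕ) : derivCoeff p l l = fun _ => 1 := by
  induction l with
  | zero => simp [derivCoeff]
  | succ l ih =>
    funext θ
    simp [derivCoeff, ih, derivCoeff_of_lt l (l + 1) (by omega)]

lemma iteratedDeriv_eq_sum_derivCoeff {p : ℕ → ℝ → ℝ} {U : Set ℝ} (hU : IsOpen U)
    (hp : ∀ i, ContDiffOn ℝ ∞ (p i) U) {m : ℕ} {v : ℕ → ℝ → ℝ}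
    (hv : ∀ l, l + 1 < m → ∀ θ ∈ U, HasDerivAt (v l) (v (l + 1) θ + p l θ * v l θ) θ) (l : ℕ)
    (hl : l < m) :
    ∀ θ ∈ U, iteratedDeriv l (v 0) θ = ∑ i ∈ Finset.range (l + 1), derivCoeff p l i θ * v i θ := by
  induction l with
  | zero => intro θ _; simp [derivCoeff]
  | succ l ih =>
    intro θ hθ
    have hc (i) : HasDerivAt (derivCoeff p l i) (deriv (derivCoeff p l i) θ) θ :=
      (((contDiffOn_derivCoeff hU hp l i).contDiffAt (hU.mem_nhds hθ)).differentiableAt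
        (by simp)).hasDerivAt
    have hsum : HasDerivAt (fun t => ∑ i ∈ Finset.range (l + 1), derivCoeff p l i t * v i t)
        (∑ i ∈ Finset.range (l + 1), (deriv (derivCoeff p l i) θ * v i θ +
          derivCoeff p l i θ * (v (i + 1) θ + p i θ * v i θ))) θ :=
      HasDerivAt.fun_sum fun i hi => (hc i).mul (hv i (by rw [Finset.mem_range] at hi; omega) θ hθ)
    have hev : iteratedDeriv l (v 0) =ᶠ[nhds θ]
        fun t => ∑ i ∈ Finset.range (l + 1), derivCoeff p l i t * v i t := by
      filter_upwards [hU.mem_nhds hθ] with t ht using ih (by omega) t ht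
    rw [iteratedDeriv_succ, hev.deriv_eq, hsum.deriv, Finset.sum_range_succ' _ (l + 1)]
    simp only [derivCoeff]
    have hz := derivCoeff_of_lt (p := p) l (l + 1) (by omega)
    have h1 : ∑ i ∈ Finset.range (l + 1), (deriv (derivCoeff p l (i + 1)) θ +
        p (i + 1) θ * derivCoeff p l (i + 1) θ) * v (i + 1) θ +
        (deriv (derivCoeff p l 0) θ + p 0 θ * derivCoeff p l 0 θ) * v 0 θ =
        ∑ i ∈ Finset.range (l + 1), (deriv (derivCoeff p l i) θ +
        p i θ * derivCoeff p l i θ) * v i θ := by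
      rw [← Finset.sum_range_succ' (fun i => (deriv (derivCoeff p l i) θ +
        p i θ * derivCoeff p l i θ) * v i θ) (l + 1), Finset.sum_range_succ _ (l + 1), hz]
      simp
    simp only [add_mul _ (derivCoeff p l _ θ), Finset.sum_add_distrib]
    rw [add_right_comm, h1, ← Finset.sum_add_distrib, ← Finset.sum_add_distrib]
    refine Finset.sum_congr rfl fun i _ => ?_
    ring

/-- The Wronskian as a determinant of iterated first order operators `∂ - p_l`. -/
lemma wronskian_eq_det {p : ℕ → ℝ → ℝ} {U : Set ℝ} (hU : IsOpen U)
    (hp : ∀ i, ContDiffOn ℝ ∞ (p i) U) {m : ℕ} (v : Fin m → ℕ → ℝ → ℝ)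
    (hv : ∀ j l, l + 1 < m → ∀ θ ∈ U,
      HasDerivAt (v j l) (v j (l + 1) θ + p l θ * v j l θ) θ) {θ : ℝ} (hθ : θ ∈ U) :
    wronskian (fun j => v j 0) θ = Matrix.det (Matrix.of fun l j : Fin m => v j l θ) := by
  -- The change of rows is lower triangular with unit diagonal, hence has determinant `1`.
  set A : Matrix (Fin m) (Fin m) ℝ := Matrix.of fun l i : Fin m => derivCoeff p l i θ with hA
  have hAdet : A.det = 1 := by
    rw [Matrix.det_of_isLowerTriangular]
    · simp [hA, derivCoeff_self]
    · intro i j hij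
      simp [hA, derivCoeff_of_lt (p := p) i j (by simpa using hij)]
  have : (Matrix.of fun i j : Fin m => iteratedDeriv (i : ℕ) (v j 0) θ) =
      A * Matrix.of fun l j : Fin m => v j l θ := by
    ext l j
    rw [Matrix.of_apply, iteratedDeriv_eq_sum_derivCoeff hU hp (hv j) l l.2 θ hθ, Matrix.mul_apply]
    simp only [hA, Matrix.of_apply]
    rw [Fin.sum_univ_eq_sum_range (fun i => derivCoeff p l i θ * v j i θ) m]
    refine Finset.sum_subset (by simp) fun i _ hi => ?_
    rw [derivCoeff_of_lt _ i (by simpa using hi), zero_mul]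
  rw [wronskian, this, Matrix.det_mul, hAdet, one_mul]

lemma param_of_lt {m m' n j : ℕ} (hj : j < m) :
    param m m' n j = j + (j - (m - m')) := by
  unfold param
  split_ifs <;> omega

lemma param_self (m m' n : ℕ) : param m m' n m = m' + m + n := by
  simp [param]

lemma contDiffOn_ladderLogDeriv {U : Set ℝ} {s l : ℕ} (hs : ∀ θ ∈ U, Real.sin θ ≠ 0)
    (hc : s < l → ∀ θ ∈ U, Real.cos θ ≠ 0) : ContDiffOn ℝ ∞ (ladderLogDeriv s l) U := by
  have h1 : ContDiffOn ℝ ∞ (fun θ => (l : ℝ) * (Real.cos θ / Real.sin θ)) U :=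
    contDiffOn_const.mul (Real.contDiff_cos.contDiffOn.div Real.contDiff_sin.contDiffOn hs)
  rcases lt_or_ge s l with h | h
  · exact h1.sub (contDiffOn_const.mul
      (Real.contDiff_sin.contDiffOn.div Real.contDiff_cos.contDiffOn (hc h)))
  · refine h1.congr fun θ _ => ?_
    simp [ladderLogDeriv, Nat.sub_eq_zero_of_le h]

lemma wronskian_chi_eq_prod {m m' n : ℕ} (hmm : m' ≤ m) (hn : Even n) {θ : ℝ}
    (hs : Real.sin θ ≠ 0) (hc : m' ≠ 0 → Real.cos θ ≠ 0) :
    wronskian (chi m m' n) θ =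
      ∏ j ∈ Finset.range m, ladderFun (param m m' n (j + 1)) (m - m') (j + 1) θ := by
  set U : Set ℝ := {t | Real.sin t ≠ 0 ∧ (m' ≠ 0 → Real.cos t ≠ 0)} with hUdef
  have hU : IsOpen U := by
    have h1 := isOpen_ne_fun Real.continuous_sin (continuous_const (y := (0 : ℝ)))
    by_cases h : m' = 0
    · simpa [hUdef, h] using h1
    · simpa [hUdef, h, Set.ofPred_and] using
        h1.inter (isOpen_ne_fun Real.continuous_cos (continuous_const (y := (0 : ℝ))))
  -- With one-based index `j`: either `k_j = j ≤ s`, or `k_j + s = 2j`, or, for the last index, `k_m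
  -- + s = 2m + n`; only the last case needs `n` even.
  have hpar (j : ℕ) (hj : j < m) : param m m' n (j + 1) ≤ m - m' ∨
      Even (param m m' n (j + 1) + (m - m')) := by
    rcases (Nat.succ_le_of_lt hj).lt_or_eq with h | h
    · rw [param_of_lt h]
      rcases le_or_gt (j + 1) (m - m') with h' | h'
      · left; omega
      · right; exact ⟨j + 1, by omega⟩
    · rw [show j + 1 = m from h, param_self]
      right; grind
  have hpos (j : ℕ) : param m m' n (j + 1) ≠ 0 := by
    unfold param; split_ifs <;> omega
  let v : Fin m → ℕ → ℝ → ℝ := fun j l => ladderFun (param m m' n (j + 1)) (m - m') (l + 1)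
  -- Levels that are never used are set to zero, since for `m' = 0` they would involve `tan`,
  -- singular at points of `U` where the cosine vanishes.
  let p : ℕ → ℝ → ℝ := fun l => if l + 1 < m then ladderLogDeriv (m - m') (l + 1) else fun _ => 0
  have hp (i : ℕ) : ContDiffOn ℝ ∞ (p i) U := by
    by_cases h : i + 1 < m
    · simp only [p, h, if_true]
      exact contDiffOn_ladderLogDeriv (fun t ht => ht.1) fun h' t ht => ht.2 (by omega)
    · simp only [p, h, if_false]
      exact contDiffOn_const
  have hv (j : Fin m) (l : ℕ) (hl : l + 1 < m) (t : ℝ) (ht : t ∈ U) :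
      HasDerivAt (v j l) (v j (l + 1) t + p l t * v j l t) t := by
    simp only [p, hl, if_true]
    exact hasDerivAt_ladderFun (hpar j j.2) ht.1 fun h' => ht.2 (by omega)
  have hchi : chi m m' n = fun j => v j 0 := by
    funext j t
    exact (ladderFun_one (hpar j j.2) (hpos j) t).symm
  rw [hchi, wronskian_eq_det hU hp v hv ⟨hs, hc⟩, Matrix.det_of_isUpperTriangular]
  · exact Fin.prod_univ_eq_prod_range
      (fun j => ladderFun (param m m' n (j + 1)) (m - m') (j + 1) θ) m
  · intro i j hij
    have hij : j < i := hij
    have hj : (j : ℕ) + 1 < m := by omega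
    simp only [Matrix.of_apply, v, ladderFun]
    rw [ladder_eq_zero (by rw [param_of_lt hj]; omega)]
    simp

/-! ### Equilibrium on the circle and the Heine–Stieltjes equation -/

/-- The Euler operator `X ∂`. -/
def euler (p : ℂ[X]) : ℂ[X] := X * derivative p

lemma coeff_euler (p : ℂ[X]) (i : ℕ) : (euler p).coeff i = i * p.coeff i := by
  rcases i with _ | i
  · simp [euler]
  · rw [euler, coeff_X_mul, coeff_derivative]; push_cast; ring

/-- The points `z_0, …, z_{n+1}` of the unit circle: distinct, with `z_0 = 1`, `z_{n+1} = -1`, closed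
under inversion, and in equilibrium with charges `m, 1, …, 1, m'`. -/
structure IsEquilibrium (m m' n : ℕ) (ζ : Fin (n + 2) → ℂ) : Prop where
  injective : Function.Injective ζ
  ne_zero : ∀ i, ζ i ≠ 0
  first : ζ 0 = 1
  last : ζ (Fin.last (n + 1)) = -1
  inv : ∀ i, ∃ j, ζ j = (ζ i)⁻¹
  critical : ∀ j : Fin n,
    ∑ i ∈ Finset.univ.erase (inner1 j),
      (mult m m' n i : ℂ) * (ζ i + ζ (inner1 j)) / (ζ i - ζ (inner1 j)) = 0

lemma inner1_injective {n : ℕ} : Function.Injective (inner1 (n := n)) := fun a b h => by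
  simpa [inner1] using h

lemma inner1_ne_zero {n : ℕ} (j : Fin n) : inner1 j ≠ 0 := by
  simp [inner1, Fin.ext_iff]

lemma inner1_ne_last {n : ℕ} (j : Fin n) : inner1 j ≠ Fin.last (n + 1) := by
  simp only [inner1, ne_eq, Fin.ext_iff, Fin.val_castSucc, Fin.val_succ, Fin.val_last]; omega

lemma eq_zero_or_inner1_or_last {n : ℕ} (i : Fin (n + 2)) :
    i = 0 ∨ (∃ j, i = inner1 j) ∨ i = Fin.last (n + 1) := by
  refine Fin.lastCases (Or.inr (Or.inr rfl)) (fun i => ?_) i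
  refine Fin.cases (Or.inl rfl) (fun j => Or.inr (Or.inl ⟨j, rfl⟩)) i

lemma sum_fin_eq_inner1 {n : ℕ} (f : Fin (n + 2) → ℂ) :
    ∑ i, f i = f 0 + ∑ j : Fin n, f (inner1 j) + f (Fin.last (n + 1)) := by
  rw [Fin.sum_univ_castSucc, Fin.sum_univ_succ]; rfl

lemma eval_derivative_prod_X_sub_C {ι : Type*} [DecidableEq ι] (s : Finset ι) (Z : ι → ℂ) {w : ℂ}
    (hw : ∀ j ∈ s, w ≠ Z j) :
    (derivative (∏ j ∈ s, (X - C (Z j)))).eval w =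
      (∏ j ∈ s, (X - C (Z j))).eval w * ∑ j ∈ s, (w - Z j)⁻¹ := by
  rw [derivative_prod_finset, eval_finsetSum, Finset.mul_sum]
  refine Finset.sum_congr rfl fun j hj => ?_
  have : w - Z j ≠ 0 := sub_ne_zero.2 (hw j hj)
  rw [← Finset.mul_prod_erase s _ hj]
  simp only [derivative_sub, derivative_X, derivative_C, sub_zero, mul_one, eval_mul, eval_sub,
    eval_X, eval_C]
  field_simp

/-- The polynomial `∏ (X - z_j)` over the charges `1`. -/
def rootPoly {n : ℕ} (ζ : Fin (n + 2) → ℂ) : ℂ[X] := ∏ j : Fin n, (X - C (ζ (inner1 j)))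

lemma natDegree_rootPoly {n : ℕ} (ζ : Fin (n + 2) → ℂ) : (rootPoly ζ).natDegree = n := by
  rw [rootPoly, natDegree_prod_of_monic _ _ fun j _ => monic_X_sub_C _]
  simp

lemma coeff_rootPoly_self {n : ℕ} (ζ : Fin (n + 2) → ℂ) : (rootPoly ζ).coeff n = 1 := by
  have : (rootPoly ζ).Monic := monic_prod_of_monic _ _ fun j _ => monic_X_sub_C _
  have h := this.coeff_natDegree
  rwa [natDegree_rootPoly] at h

lemma eval_rootPoly {n : ℕ} (ζ : Fin (n + 2) → ℂ) (w : ℂ) :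
    (rootPoly ζ).eval w = ∏ j : Fin n, (w - ζ (inner1 j)) := by
  simp [rootPoly, eval_prod]

namespace IsEquilibrium

variable {m m' n : ℕ} {ζ : Fin (n + 2) → ℂ}

lemma inner1_ne_one (h : IsEquilibrium m m' n ζ) (j : Fin n) : ζ (inner1 j) ≠ 1 := fun e =>
  inner1_ne_zero j (h.injective (e.trans h.first.symm))

lemma inner1_ne_neg_one (h : IsEquilibrium m m' n ζ) (j : Fin n) : ζ (inner1 j) ≠ -1 := fun e =>
  inner1_ne_last j (h.injective (e.trans h.last.symm))

lemma exists_perm (h : IsEquilibrium m m' n ζ) :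
    ∃ σ : Equiv.Perm (Fin n), ∀ j, ζ (inner1 (σ j)) = (ζ (inner1 j))⁻¹ := by
  have h1 (j : Fin n) : ∃ j', ζ (inner1 j') = (ζ (inner1 j))⁻¹ := by
    obtain ⟨i, hi⟩ := h.inv (inner1 j)
    rcases eq_zero_or_inner1_or_last i with rfl | ⟨j', rfl⟩ | rfl
    · rw [h.first, eq_comm, inv_eq_one] at hi
      exact absurd hi (h.inner1_ne_one j)
    · exact ⟨j', hi⟩
    · rw [h.last, eq_comm, inv_eq_iff_eq_inv] at hi
      exact absurd (by simpa using hi) (h.inner1_ne_neg_one j)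
  choose f hf using h1
  have hinj : Function.Injective f := fun a b hab =>
    inner1_injective (h.injective (inv_injective (by rw [← hf a, ← hf b, hab])))
  exact ⟨Equiv.ofBijective f (Finite.injective_iff_bijective.1 hinj), hf⟩

lemma prod_inv (h : IsEquilibrium m m' n ζ) (F : ℂ → ℂ) :
    ∏ j : Fin n, F (ζ (inner1 j))⁻¹ = ∏ j : Fin n, F (ζ (inner1 j)) := by
  obtain ⟨σ, hσ⟩ := h.exists_perm
  simp only [← hσ]
  exact Equiv.prod_comp σ fun j => F (ζ (inner1 j))

lemma sum_inv (h : IsEquilibrium m m' n ζ) (F : ℂ → ℂ) :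
    ∑ j : Fin n, F (ζ (inner1 j))⁻¹ = ∑ j : Fin n, F (ζ (inner1 j)) := by
  obtain ⟨σ, hσ⟩ := h.exists_perm
  simp only [← hσ]
  exact Equiv.sum_comp σ fun j => F (ζ (inner1 j))

/-- Multiply `1 - z = -z (1 - z⁻¹)` over all `z_j`: inversion permutes them, so the nonzero product
of the `1 - z_j` cancels. -/
lemma prod_neg (h : IsEquilibrium m m' n ζ) : ∏ j : Fin n, (-ζ (inner1 j)) = 1 := by
  have h1 := h.prod_inv fun z => 1 - z
  have h2 : ∏ j : Fin n, (1 - ζ (inner1 j)) ≠ 0 :=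
    Finset.prod_ne_zero_iff.2 fun j _ => sub_ne_zero.2 (h.inner1_ne_one j).symm
  have h3 : ∏ j : Fin n, (1 - ζ (inner1 j)) =
      (∏ j : Fin n, (-ζ (inner1 j))) * ∏ j : Fin n, (1 - (ζ (inner1 j))⁻¹) := by
    rw [← Finset.prod_mul_distrib]
    refine Finset.prod_congr rfl fun j _ => ?_
    have := h.ne_zero (inner1 j)
    field_simp; ring
  rw [h1] at h3
  exact mul_right_cancel₀ h2 (h3.symm.trans (one_mul _).symm)

/-- The same argument with `1 + z = z (1 + z⁻¹)` gives `∏ z_j = 1`; comparison with `prod_neg`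
yields `(-1)^n = 1`. -/
lemma even (h : IsEquilibrium m m' n ζ) : Even n := by
  have h1 := h.prod_inv fun z => 1 + z
  have h2 : ∏ j : Fin n, (1 + ζ (inner1 j)) ≠ 0 :=
    Finset.prod_ne_zero_iff.2 fun j _ e => h.inner1_ne_neg_one j (by linear_combination e)
  have h3 : ∏ j : Fin n, (1 + ζ (inner1 j)) =
      (∏ j : Fin n, ζ (inner1 j)) * ∏ j : Fin n, (1 + (ζ (inner1 j))⁻¹) := by
    rw [← Finset.prod_mul_distrib]
    refine Finset.prod_congr rfl fun j _ => ?_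
    have := h.ne_zero (inner1 j)
    field_simp; ring
  rw [h1] at h3
  have h4 : ∏ j : Fin n, ζ (inner1 j) = 1 :=
    mul_right_cancel₀ h2 (h3.symm.trans (one_mul _).symm)
  have h5 := h.prod_neg
  rw [Finset.prod_neg, h4, mul_one, Finset.card_univ, Fintype.card_fin] at h5
  exact (neg_one_pow_eq_one_iff_even (by norm_num)).1 h5

/-- Since `(1 - z⁻¹)⁻¹ + (1 - z)⁻¹ = 1`, averaging over inversion gives `∑ (1 - z_j)⁻¹ = n / 2`. -/
lemma eval_derivative_one (h : IsEquilibrium m m' n ζ) :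
    (derivative (rootPoly ζ)).eval 1 = n / 2 * (rootPoly ζ).eval 1 := by
  rw [rootPoly, eval_derivative_prod_X_sub_C _ _ fun j _ => (h.inner1_ne_one j).symm, mul_comm]
  congr 1
  have h1 := h.sum_inv fun z => (1 - z)⁻¹
  have h2 : ∑ j : Fin n, ((1 - (ζ (inner1 j))⁻¹)⁻¹ + (1 - ζ (inner1 j))⁻¹) =
      ∑ j : Fin n, (1 : ℂ) := by
    refine Finset.sum_congr rfl fun j _ => ?_
    have h0 := h.ne_zero (inner1 j)
    have h3 : 1 - ζ (inner1 j) ≠ 0 := sub_ne_zero.2 (h.inner1_ne_one j).symm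
    have h4 : 1 - (ζ (inner1 j))⁻¹ = -(1 - ζ (inner1 j)) / ζ (inner1 j) := by field_simp; ring
    rw [h4]; field_simp; ring
  rw [Finset.sum_add_distrib, h1] at h2
  simp only [Finset.sum_const, Finset.card_univ, Fintype.card_fin, nsmul_eq_mul, mul_one] at h2
  linear_combination h2 / 2

lemma eval_derivative_neg_one (h : IsEquilibrium m m' n ζ) :
    (derivative (rootPoly ζ)).eval (-1) = -(n / 2) * (rootPoly ζ).eval (-1) := by
  rw [rootPoly, eval_derivative_prod_X_sub_C _ _ fun j _ => (h.inner1_ne_neg_one j).symm, mul_comm]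
  congr 1
  have h1 := h.sum_inv fun z => (-1 - z)⁻¹
  have h2 : ∑ j : Fin n, ((-1 - (ζ (inner1 j))⁻¹)⁻¹ + (-1 - ζ (inner1 j))⁻¹) =
      ∑ j : Fin n, (-1 : ℂ) := by
    refine Finset.sum_congr rfl fun j _ => ?_
    have h0 := h.ne_zero (inner1 j)
    have h3 : -1 - ζ (inner1 j) ≠ 0 := sub_ne_zero.2 (h.inner1_ne_neg_one j).symm
    have h4 : -1 - (ζ (inner1 j))⁻¹ = (-1 - ζ (inner1 j)) / ζ (inner1 j) := by field_simp; ring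
    rw [h4]; field_simp; ring
  rw [Finset.sum_add_distrib, h1] at h2
  simp only [Finset.sum_const, Finset.card_univ, Fintype.card_fin, nsmul_eq_mul] at h2
  linear_combination h2 / 2

lemma critical_sum (h : IsEquilibrium m m' n ζ) (j : Fin n) :
    (n - 1 : ℂ) - 2 * ζ (inner1 j) *
        ∑ i ∈ Finset.univ.erase j, (ζ (inner1 j) - ζ (inner1 i))⁻¹ +
      m * (1 + ζ (inner1 j)) / (1 - ζ (inner1 j)) +
      m' * (-1 + ζ (inner1 j)) / (-1 - ζ (inner1 j)) = 0 := by
  have h1 := h.critical j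
  -- The omitted term `i = j` can be restored because its denominator is zero, so it has value `0`.
  rw [Finset.sum_erase _ (by simp), sum_fin_eq_inner1, h.first, h.last] at h1
  have hm0 : mult m m' n 0 = m := by simp [mult]
  have hml : mult m m' n (Fin.last (n + 1)) = m' := by simp [mult]
  have hmi (i : Fin n) : mult m m' n (inner1 i) = 1 := by
    simp [mult, inner1_ne_zero, inner1_ne_last]
  rw [hm0, hml] at h1
  simp only [hmi, Nat.cast_one, one_mul] at h1
  rw [← Finset.sum_erase Finset.univ (a := j) (by simp)] at h1
  have h2 : ∑ i ∈ Finset.univ.erase j,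
      (ζ (inner1 i) + ζ (inner1 j)) / (ζ (inner1 i) - ζ (inner1 j)) =
      (n - 1 : ℂ) - 2 * ζ (inner1 j) *
        ∑ i ∈ Finset.univ.erase j, (ζ (inner1 j) - ζ (inner1 i))⁻¹ := by
    have hcard : ∑ i ∈ (Finset.univ : Finset (Fin n)).erase j, (1 : ℂ) = n - 1 := by
      rw [Finset.sum_const, Finset.card_erase_of_mem (Finset.mem_univ j), Finset.card_univ,
        Fintype.card_fin, nsmul_eq_mul, mul_one, Nat.cast_sub (by have := j.2; omega), Nat.cast_one]
    rw [← hcard, Finset.mul_sum, ← Finset.sum_sub_distrib]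
    refine Finset.sum_congr rfl fun i hi => ?_
    have hne : ζ (inner1 j) - ζ (inner1 i) ≠ 0 := sub_ne_zero.2 fun e =>
      (Finset.ne_of_mem_erase hi) (inner1_injective (h.injective e)).symm
    have hne' : ζ (inner1 i) - ζ (inner1 j) ≠ 0 := by rwa [← neg_sub, neg_ne_zero]
    rw [div_eq_iff hne', ← neg_sub (ζ (inner1 j)) (ζ (inner1 i))]
    field_simp; ring
  rw [h2] at h1
  linear_combination h1

/-- At a simple root `P'' = 2 P' ∑_{i ≠ j} (z_j - z_i)⁻¹`, which turns the equilibrium condition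
into a relation between `P''` and `P'`. -/
lemma eval_derivative_root (h : IsEquilibrium m m' n ζ) (j : Fin n) :
    (ζ (inner1 j) ^ 2 - 1) * (ζ (inner1 j) * (derivative (derivative (rootPoly ζ))).eval (ζ (inner1 j)) -
      (n - 1) * (derivative (rootPoly ζ)).eval (ζ (inner1 j))) +
      (m * (ζ (inner1 j) + 1) ^ 2 + m' * (ζ (inner1 j) - 1) ^ 2) *
        (derivative (rootPoly ζ)).eval (ζ (inner1 j)) = 0 := by
  set S : ℂ[X] := ∏ i ∈ Finset.univ.erase j, (X - C (ζ (inner1 i))) with hS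
  have hP : rootPoly ζ = (X - C (ζ (inner1 j))) * S :=
    (Finset.mul_prod_erase _ _ (Finset.mem_univ j)).symm
  have h1 : (derivative (rootPoly ζ)).eval (ζ (inner1 j)) = S.eval (ζ (inner1 j)) := by
    simp [hP, derivative_mul]
  have h2 : (derivative (derivative (rootPoly ζ))).eval (ζ (inner1 j)) =
      2 * (derivative S).eval (ζ (inner1 j)) := by
    simp [hP, derivative_mul]; ring
  have h3 := eval_derivative_prod_X_sub_C (Finset.univ.erase j) (fun i => ζ (inner1 i))
    (w := ζ (inner1 j)) fun i hi e =>
      (Finset.ne_of_mem_erase hi) (inner1_injective (h.injective e)).symm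
  rw [← hS] at h3
  have h4 := h.critical_sum j
  have h5 : 1 - ζ (inner1 j) ≠ 0 := sub_ne_zero.2 (h.inner1_ne_one j).symm
  have h6 : -1 - ζ (inner1 j) ≠ 0 := sub_ne_zero.2 (h.inner1_ne_neg_one j).symm
  rw [h1, h2, h3]
  generalize ∑ i ∈ Finset.univ.erase j, (ζ (inner1 j) - ζ (inner1 i))⁻¹ = T at *
  generalize ζ (inner1 j) = z at *
  field_simp at h4
  linear_combination (-(S.eval z)) * h4

/-- The Heine–Stieltjes equation of the polynomial `∏ (X - z_j)`. -/
lemma rootPoly_ode (h : IsEquilibrium m m' n ζ) :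
    (X ^ 2 - 1) * (euler (euler (rootPoly ζ)) - C (n : ℂ) * euler (rootPoly ζ)) +
      (C (m : ℂ) * (X + 1) ^ 2 + C (m' : ℂ) * (X - 1) ^ 2) *
        (euler (rootPoly ζ) - C (n / 2 : ℂ) * rootPoly ζ) -
      C (n * (m + m') / 2 : ℂ) * ((X ^ 2 - 1) * rootPoly ζ) = 0 := by
  set P := rootPoly ζ with hP
  have hz (i : ℕ) (hi : n < i) : P.coeff i = 0 :=
    coeff_eq_zero_of_natDegree_lt (by rwa [natDegree_rootPoly])
  -- The left side vanishes at the `n + 2` distinct points `ζ i` and has degree at most `n + 1`.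
  refine eq_zero_of_natDegree_lt_card_of_eval_eq_zero _ h.injective (fun i => ?_) ?_
  · have hE (w : ℂ) : (euler P).eval w = w * (derivative P).eval w := by simp [euler]
    have hEE (w : ℂ) : (euler (euler P)).eval w =
        w ^ 2 * (derivative (derivative P)).eval w + w * (derivative P).eval w := by
      simp [euler, derivative_mul]; ring
    simp only [eval_add, eval_sub, eval_mul, eval_pow, eval_X, eval_one, eval_C, hE, hEE]
    rcases eq_zero_or_inner1_or_last i with rfl | ⟨j, rfl⟩ | rfl
    · rw [h.first, h.eval_derivative_one]; ring
    · have h0 : P.eval (ζ (inner1 j)) = 0 := by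
        rw [hP, eval_rootPoly]
        exact Finset.prod_eq_zero (Finset.mem_univ j) (sub_self _)
      rw [h0]
      linear_combination ζ (inner1 j) * h.eval_derivative_root j
    · rw [h.last, h.eval_derivative_neg_one]; ring
  · rw [Fintype.card_fin, Nat.lt_succ_iff, natDegree_le_iff_coeff_eq_zero]
    intro N hN
    obtain ⟨i, rfl⟩ : ∃ i, N = i + 2 := ⟨N - 2, by omega⟩
    -- Sorting by powers of `X` shows that the coefficient of `X^{n+2}` is `n² - n·n + (m + m')(n -
    -- n/2) - n (m + m')/2 = 0`.
    have hA : (X ^ 2 - 1) * (euler (euler P) - C (n : ℂ) * euler P) +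
      (C (m : ℂ) * (X + 1) ^ 2 + C (m' : ℂ) * (X - 1) ^ 2) * (euler P - C (n / 2 : ℂ) * P) -
      C (n * (m + m') / 2 : ℂ) * ((X ^ 2 - 1) * P) =
      X ^ 2 * (euler (euler P) - C (n : ℂ) * euler P + C (m + m' : ℂ) * (euler P - C (n / 2 : ℂ) * P)
        - C (n * (m + m') / 2 : ℂ) * P) +
      X * (C (2 * (m - m') : ℂ) * (euler P - C (n / 2 : ℂ) * P)) +
      (-(euler (euler P) - C (n : ℂ) * euler P) + C (m + m' : ℂ) * (euler P - C (n / 2 : ℂ) * P)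
        + C (n * (m + m') / 2 : ℂ) * P) := by
      simp only [C_add, C_sub, C_mul, C_ofNat]; ring
    rw [hA, coeff_add, coeff_add, coeff_X_pow_mul, show i + 2 = (i + 1) + 1 from rfl, coeff_X_mul]
    simp only [coeff_add, coeff_sub, coeff_neg, coeff_C_mul, coeff_euler, hz (i + 1) (by omega),
      hz (i + 1 + 1) (by omega)]
    rcases (show n ≤ i by omega).eq_or_lt with rfl | hi
    · ring
    · rw [hz i hi]; ring

end IsEquilibrium

/-! ### From the variable `e^{2iθ}` to `cos θ` -/

lemma zCoord_ne_zero (θ : ℝ) : zCoord θ ≠ 0 := Complex.exp_ne_zero _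

lemma hasDerivAt_zCoord (θ : ℝ) : HasDerivAt zCoord (2 * Complex.I * zCoord θ) θ := by
  have h : HasDerivAt (fun t : ℝ => 2 * Complex.I * (t : ℂ)) (2 * Complex.I) θ := by
    simpa using (Complex.ofRealCLM.hasDerivAt (x := θ)).const_mul (2 * Complex.I)
  exact h.cexp.congr_deriv (mul_comm _ _)

/-- The function `e^{-inθ} G(e^{2iθ})`. -/
def laurentFun (n : ℕ) (G : ℂ[X]) (θ : ℝ) : ℂ :=
  G.eval (zCoord θ) * Complex.exp (-(Complex.I * (n : ℂ) * (θ : ℂ)))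

lemma hasDerivAt_laurentFun (n : ℕ) (G : ℂ[X]) (θ : ℝ) :
    HasDerivAt (laurentFun n G)
      (2 * Complex.I * laurentFun n (euler G - C (n / 2 : ℂ) * G) θ) θ := by
  have h1 : HasDerivAt (fun t : ℝ => -(Complex.I * (n : ℂ) * (t : ℂ))) (-(Complex.I * n)) θ := by
    simpa using ((Complex.ofRealCLM.hasDerivAt (x := θ)).const_mul (Complex.I * n)).fun_neg
  have h2 := (G.hasDerivAt (zCoord θ)).comp θ (hasDerivAt_zCoord θ)
  refine (h2.mul h1.cexp).congr_deriv ?_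
  simp only [laurentFun, euler, eval_sub, eval_mul, eval_X, eval_C, Function.comp_apply]
  ring

lemma zCoord_eq_sq (θ : ℝ) : zCoord θ = Complex.exp (Complex.I * θ) ^ 2 := by
  rw [zCoord, ← Complex.exp_nat_mul]; congr 1; push_cast; ring

lemma sin_mul_exp (θ : ℝ) : 2 * Complex.I * (Real.sin θ : ℂ) * Complex.exp (Complex.I * θ) =
    zCoord θ - 1 := by
  have h : Complex.exp (Complex.I * θ) = Complex.cos θ + Complex.sin θ * Complex.I := by
    rw [mul_comm, Complex.exp_mul_I]
  rw [zCoord_eq_sq, h, Complex.ofReal_sin]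
  linear_combination Complex.cos_sq_add_sin_sq (θ : ℂ) * (-1) +
    (Complex.sin (θ : ℂ)) ^ 2 * Complex.I_sq

lemma cos_mul_exp (θ : ℝ) : 2 * (Real.cos θ : ℂ) * Complex.exp (Complex.I * θ) =
    zCoord θ + 1 := by
  have h : Complex.exp (Complex.I * θ) = Complex.cos θ + Complex.sin θ * Complex.I := by
    rw [mul_comm, Complex.exp_mul_I]
  rw [zCoord_eq_sq, h, Complex.ofReal_cos]
  linear_combination Complex.cos_sq_add_sin_sq (θ : ℂ) -
    (Complex.sin (θ : ℂ)) ^ 2 * Complex.I_sq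

lemma exp_I_mul_zCoord_pow (n i : ℕ) (θ : ℝ) :
    zCoord θ ^ i * Complex.exp (-(Complex.I * (n : ℂ) * (θ : ℂ))) =
      Complex.exp (((2 * i - n : ℂ) * θ) * Complex.I) := by
  rw [zCoord, ← Complex.exp_nat_mul, ← Complex.exp_add]; congr 1; ring

/-- The polynomial `q` with `q (cos θ) = Q(θ)`, in the basis of Chebyshev polynomials. -/
def cosPoly {n : ℕ} (ζ : Fin (n + 2) → ℂ) : ℂ[X] :=
  ∑ i ∈ Finset.range (n + 1), C ((rootPoly ζ).coeff i) * Chebyshev.T ℂ (2 * i - n)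

lemma coeff_cosPoly_of_lt {n : ℕ} (ζ : Fin (n + 2) → ℂ) {i : ℕ} (hi : n < i) :
    (cosPoly ζ).coeff i = 0 := by
  rw [cosPoly, finsetSum_coeff]
  refine Finset.sum_eq_zero fun j hj => ?_
  rw [coeff_C_mul, coeff_eq_zero_of_natDegree_lt (p := Chebyshev.T ℂ _), mul_zero]
  rw [Chebyshev.natDegree_T]
  rw [Finset.mem_range] at hj
  omega

namespace IsEquilibrium

variable {m m' n : ℕ} {ζ : Fin (n + 2) → ℂ}

lemma coeff_rootPoly_zero (h : IsEquilibrium m m' n ζ) : (rootPoly ζ).coeff 0 = 1 := by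
  rw [coeff_zero_eq_eval_zero, eval_rootPoly, ← h.prod_neg]
  simp

lemma coeff_cosPoly_self (h : IsEquilibrium m m' n ζ) : (cosPoly ζ).coeff n = 2 ^ n := by
  rcases n with _ | k
  · simp [cosPoly, h.coeff_rootPoly_zero]
  rw [cosPoly, finsetSum_coeff, Finset.sum_range_succ, Finset.sum_range_succ', Finset.sum_eq_zero]
  · have h1 : (2 * ((k + 1 : ℕ) : ℤ) - (k + 1 : ℕ)) = (k + 1 : ℕ) := by ring
    have h2 : (2 * ((0 : ℕ) : ℤ) - (k + 1 : ℕ)) = -(k + 1 : ℕ) := by simp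
    -- The extreme terms `T_n` and `T_{-n} = T_n` each contribute `2^{n-1}`.
    rw [h1, h2, Chebyshev.T_neg, coeff_C_mul, coeff_C_mul, chebyshevT_coeff_self,
      coeff_rootPoly_self, h.coeff_rootPoly_zero, Nat.add_sub_cancel, pow_succ]
    ring
  · intro j hj
    rw [coeff_C_mul, coeff_eq_zero_of_natDegree_lt (p := Chebyshev.T ℂ _), mul_zero]
    rw [Chebyshev.natDegree_T]
    rw [Finset.mem_range] at hj
    omega

lemma laurentFun_neg (h : IsEquilibrium m m' n ζ) (θ : ℝ) :
    laurentFun n (rootPoly ζ) (-θ) = laurentFun n (rootPoly ζ) θ := by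
  have hz : zCoord (-θ) = (zCoord θ)⁻¹ := by
    rw [zCoord, zCoord, ← Complex.exp_neg]; congr 1; push_cast; ring
  have h0 := zCoord_ne_zero θ
  have h1 : (rootPoly ζ).eval (zCoord θ) = zCoord θ ^ n * (rootPoly ζ).eval (zCoord θ)⁻¹ := by
    rw [eval_rootPoly, eval_rootPoly, ← h.prod_inv fun z => (zCoord θ)⁻¹ - z]
    rw [← one_mul (∏ j : Fin n, (zCoord θ - ζ (inner1 j))), ← h.prod_neg,
      ← h.prod_inv fun z => -z]
    have hc : zCoord θ ^ n = ∏ j : Fin n, zCoord θ := by simp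
    rw [hc, ← Finset.prod_mul_distrib, ← Finset.prod_mul_distrib]
    refine Finset.prod_congr rfl fun j _ => ?_
    have := h.ne_zero (inner1 j)
    field_simp; ring
  have h2 : zCoord θ ^ n * Complex.exp (-(Complex.I * (n : ℂ) * (θ : ℂ))) =
      Complex.exp (-(Complex.I * (n : ℂ) * ((-θ : ℝ) : ℂ))) := by
    rw [exp_I_mul_zCoord_pow]; congr 1; push_cast; ring
  rw [laurentFun, laurentFun, hz, h1, ← h2]; ring

lemma eval_cosPoly (h : IsEquilibrium m m' n ζ) (θ : ℝ) :
    (cosPoly ζ).eval (Real.cos θ : ℂ) = laurentFun n (rootPoly ζ) θ := by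
  have h1 (t : ℝ) : laurentFun n (rootPoly ζ) t =
      ∑ i ∈ Finset.range (n + 1),
        (rootPoly ζ).coeff i * Complex.exp (((2 * i - n : ℂ) * t) * Complex.I) := by
    rw [laurentFun, eval_eq_sum_range, natDegree_rootPoly, Finset.sum_mul]
    refine Finset.sum_congr rfl fun i _ => ?_
    rw [mul_assoc, exp_I_mul_zCoord_pow]
  -- Averaging over `θ ↦ -θ`, under which the function is invariant, turns each exponential into a
  -- cosine.
  have h2 : laurentFun n (rootPoly ζ) θ =
      (laurentFun n (rootPoly ζ) θ + laurentFun n (rootPoly ζ) (-θ)) / 2 := by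
    rw [h.laurentFun_neg]; ring
  rw [h2, h1, h1, ← Finset.sum_add_distrib, Finset.sum_div, cosPoly, eval_finsetSum]
  refine Finset.sum_congr rfl fun i _ => ?_
  rw [eval_mul, eval_C, Complex.ofReal_cos, Chebyshev.T_complex_cos, Complex.cos]
  push_cast
  rw [show -((2 * (i : ℂ) - n) * θ) * Complex.I = (2 * (i : ℂ) - n) * -θ * Complex.I by ring]
  ring

/-- The trigonometric form of the Heine–Stieltjes equation. -/
lemma laurentFun_ode (h : IsEquilibrium m m' n ζ) (θ : ℝ) :
    (Real.sin θ * Real.cos θ : ℂ) * deriv (deriv (laurentFun n (rootPoly ζ))) θ +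
      2 * (m * (Real.cos θ : ℂ) ^ 2 - m' * (Real.sin θ : ℂ) ^ 2) *
        deriv (laurentFun n (rootPoly ζ)) θ +
      ((n : ℂ) ^ 2 + 2 * n * (m + m')) * (Real.sin θ * Real.cos θ) *
        laurentFun n (rootPoly ζ) θ = 0 := by
  have hd (G : ℂ[X]) : deriv (laurentFun n G) =
      fun t => 2 * Complex.I * laurentFun n (euler G - C (n / 2 : ℂ) * G) t :=
    funext fun t => (hasDerivAt_laurentFun n G t).deriv
  have hd2 (G : ℂ[X]) (t : ℝ) : deriv (fun t => 2 * Complex.I * laurentFun n G t) t =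
      2 * Complex.I * deriv (laurentFun n G) t := by
    rw [((hasDerivAt_laurentFun n G t).const_mul _).deriv, (hasDerivAt_laurentFun n G t).deriv]
  rw [hd, hd2, hd]
  have hee : euler (euler (rootPoly ζ) - C (n / 2 : ℂ) * rootPoly ζ) =
      euler (euler (rootPoly ζ)) - C (n / 2 : ℂ) * euler (rootPoly ζ) := by
    simp only [euler, derivative_sub, derivative_C_mul]; ring
  rw [hee]
  have h1 := congr_arg (eval (zCoord θ)) h.rootPoly_ode
  have hs := sin_mul_exp θ
  have hc := cos_mul_exp θ
  have he := zCoord_eq_sq θ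
  have hE : Complex.exp (Complex.I * θ) ≠ 0 := Complex.exp_ne_zero _
  simp only [eval_add, eval_sub, eval_mul, eval_pow, eval_X, eval_one, eval_C, eval_zero,
    laurentFun] at h1 ⊢
  have e1 : zCoord θ ^ 2 - 1 = 4 * Complex.I * (Real.sin θ * Real.cos θ) * zCoord θ := by
    nth_rewrite 2 [he]
    linear_combination -(zCoord θ + 1) * hs - 2 * Complex.I * (Real.sin θ : ℂ) *
      Complex.exp (Complex.I * θ) * hc
  have e2 : (zCoord θ + 1) ^ 2 = 4 * (Real.cos θ : ℂ) ^ 2 * zCoord θ := by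
    rw [← hc, he]; ring
  have e3 : (zCoord θ - 1) ^ 2 = -4 * (Real.sin θ : ℂ) ^ 2 * zCoord θ := by
    rw [← hs, he]; linear_combination 4 * (Real.sin θ : ℂ) ^ 2 * Complex.exp (Complex.I * θ) ^ 2 *
      Complex.I_sq
  rw [e1, e2, e3] at h1
  have h2 := mul_left_cancel₀ (zCoord_ne_zero θ) (a := zCoord θ) (c := 0) (b :=
    4 * Complex.I * (Real.sin θ * Real.cos θ) * (eval (zCoord θ) (euler (euler (rootPoly ζ))) -
      n * eval (zCoord θ) (euler (rootPoly ζ))) +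
    4 * (m * (Real.cos θ : ℂ) ^ 2 - m' * (Real.sin θ : ℂ) ^ 2) *
      (eval (zCoord θ) (euler (rootPoly ζ)) - n / 2 * eval (zCoord θ) (rootPoly ζ)) -
    n * (m + m') / 2 * (4 * Complex.I * (Real.sin θ * Real.cos θ) * eval (zCoord θ) (rootPoly ζ)))
    (by linear_combination h1)
  generalize Complex.exp (-(Complex.I * (n : ℂ) * (θ : ℂ))) = ε
  generalize (Real.sin θ : ℂ) = s at *
  generalize (Real.cos θ : ℂ) = c at *
  generalize eval (zCoord θ) (euler (euler (rootPoly ζ))) = P2 at *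
  generalize eval (zCoord θ) (euler (rootPoly ζ)) = P1 at *
  generalize eval (zCoord θ) (rootPoly ζ) = P0 at *
  linear_combination ε * Complex.I * h2 + (ε * s * c * (n * P0 * (m + m') * 2 + P0 * n ^ 2)) * Complex.I_sq

lemma cosPoly_ode (h : IsEquilibrium m m' n ζ) :
    (1 - X ^ 2) * (euler (euler (cosPoly ζ)) - euler (cosPoly ζ)) +
      (C (2 * m' : ℂ) * (1 - X ^ 2) - C (2 * m + 1 : ℂ) * X ^ 2) * euler (cosPoly ζ) +
      C ((n : ℂ) ^ 2 + 2 * n * (m + m')) * (X ^ 2 * cosPoly ζ) = 0 := by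
  set q := cosPoly ζ with hq
  have hQ : laurentFun n (rootPoly ζ) = fun t : ℝ => q.eval (Real.cos t : ℂ) :=
    funext fun t => (h.eval_cosPoly t).symm
  have hcos (t : ℝ) : HasDerivAt (fun t : ℝ => (Real.cos t : ℂ)) (-(Real.sin t : ℂ)) t := by
    simpa using (Real.hasDerivAt_cos t).ofReal_comp
  have hsin (t : ℝ) : HasDerivAt (fun t : ℝ => (Real.sin t : ℂ)) (Real.cos t : ℂ) t :=
    (Real.hasDerivAt_sin t).ofReal_comp
  have hp (p : ℂ[X]) (t : ℝ) : HasDerivAt (fun t : ℝ => p.eval (Real.cos t : ℂ))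
      ((derivative p).eval (Real.cos t : ℂ) * -(Real.sin t : ℂ)) t :=
    (p.hasDerivAt _).comp t (hcos t)
  have hd : deriv (laurentFun n (rootPoly ζ)) =
      fun t : ℝ => (derivative q).eval (Real.cos t : ℂ) * -(Real.sin t : ℂ) := by
    rw [hQ]; exact funext fun t => (hp q t).deriv
  -- It suffices to check the identity at `y = cos θ` for `y` in `(-1, 1)`, where `sin θ` is nonzero
  -- and can be cancelled.
  refine eq_zero_of_infinite_isRoot _ (Set.Infinite.mono (s := Complex.ofReal '' Set.Ioo (-1) 1) ?_
    ((Set.Ioo_infinite (by norm_num)).image Complex.ofReal_injective.injOn))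
  rintro _ ⟨y, hy, rfl⟩
  set θ := Real.arccos y with hθ
  have hy' : Real.cos θ = y := Real.cos_arccos hy.1.le hy.2.le
  have hs : (Real.sin θ : ℂ) ≠ 0 := by
    rw [Complex.ofReal_ne_zero, hθ, Real.sin_arccos]
    exact (Real.sqrt_pos.2 (by nlinarith [hy.1, hy.2])).ne'
  have h1 := h.laurentFun_ode θ
  have hdd : deriv (fun t : ℝ => (derivative q).eval (Real.cos t : ℂ) * -(Real.sin t : ℂ)) θ = _ :=
    ((hp (derivative q) θ).mul (hsin θ).fun_neg).deriv
  rw [hd, hdd, hQ] at h1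
  beta_reduce at h1
  have hcs : (Real.sin θ : ℂ) ^ 2 = 1 - (Real.cos θ : ℂ) ^ 2 := by
    have := Real.sin_sq θ
    exact_mod_cast this
  simp only [Set.mem_ofPred_eq, IsRoot.def, euler, derivative_mul, derivative_X, one_mul, eval_add,
    eval_sub, eval_mul, eval_pow, eval_X, eval_one, eval_C]
  rw [← hy']
  refine mul_left_cancel₀ hs (Eq.trans ?_ (mul_zero _).symm)
  generalize (Real.sin θ : ℂ) = s at *
  generalize (Real.cos θ : ℂ) = c at *
  generalize eval c (derivative (derivative q)) = q2 at *
  generalize eval c (derivative q) = q1 at *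
  generalize eval c q = q0 at *
  linear_combination c * h1 - (s * (c ^ 2 * q2 + 2 * m' * c * q1)) * hcs

lemma cosPoly_coeff_recurrence (h : IsEquilibrium m m' n ζ) (i : ℕ) :
    ((i : ℂ) + 2) * (i + 1 + 2 * m') * (cosPoly ζ).coeff (i + 2) +
      (((m' + m + n : ℕ) : ℂ) ^ 2 - (i + m + m') ^ 2) * (cosPoly ζ).coeff i = 0 := by
  have h1 := congr_arg (fun p => p.coeff (i + 2)) h.cosPoly_ode
  have e : (1 - X ^ 2) * (euler (euler (cosPoly ζ)) - euler (cosPoly ζ)) +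
      (C (2 * m' : ℂ) * (1 - X ^ 2) - C (2 * m + 1 : ℂ) * X ^ 2) * euler (cosPoly ζ) +
      C ((n : ℂ) ^ 2 + 2 * n * (m + m')) * (X ^ 2 * cosPoly ζ) =
      X ^ 2 * (C ((n : ℂ) ^ 2 + 2 * n * (m + m')) * cosPoly ζ -
        C (2 * m' + 2 * m : ℂ) * euler (cosPoly ζ) - euler (euler (cosPoly ζ))) +
      (euler (euler (cosPoly ζ)) - euler (cosPoly ζ) + C (2 * m' : ℂ) * euler (cosPoly ζ)) := by
    simp only [C_add, C_mul, C_1]; ring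
  rw [e] at h1
  simp only [coeff_add, coeff_X_pow_mul, coeff_sub, coeff_C_mul, coeff_euler, coeff_zero] at h1
  push_cast at h1 ⊢
  linear_combination h1

end IsEquilibrium

/-! ### Uniqueness for the recurrence -/

/-- Solutions of the two-term recurrence are determined by the top coefficient. -/
lemma proportional_of_recurrence {m m' n : ℕ} {r q : ℕ → ℂ}
    (hr : ∀ i : ℕ, ((i : ℂ) + 2) * (i + 1 + 2 * m') * r (i + 2) +
      (((m' + m + n : ℕ) : ℂ) ^ 2 - (i + m + m') ^ 2) * r i = 0)
    (hq : ∀ i : ℕ, ((i : ℂ) + 2) * (i + 1 + 2 * m') * q (i + 2) +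
      (((m' + m + n : ℕ) : ℂ) ^ 2 - (i + m + m') ^ 2) * q i = 0)
    (hr0 : ∀ i, n < i → r i = 0) (hq0 : ∀ i, n < i → q i = 0) (i : ℕ) :
    q n * r i = r n * q i := by
  have key : ∀ d i, n < i + d → q n * r i = r n * q i := by
    intro d
    induction d using Nat.strong_induction_on with
    | _ d ih =>
      intro i hi
      rcases lt_trichotomy n i with h | rfl | h
      · rw [hr0 i h, hq0 i h]; ring
      · ring
      · have h2 : q n * r (i + 2) = r n * q (i + 2) := by
          rcases d with _ | _ | d
          · omega
          · omega
          · exact ih d (by omega) (i + 2) (by omega)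
        -- For `i < n` this factor is nonzero, so the recurrence can be solved downwards from index
        -- `n`.
        have hne : (((m' + m + n : ℕ) : ℂ) ^ 2 - (i + m + m') ^ 2) ≠ 0 := by
          rw [sub_ne_zero]
          have : (i + m + m') ^ 2 < (m' + m + n) ^ 2 := Nat.pow_lt_pow_left (by omega) (by omega)
          exact_mod_cast this.ne'
        refine mul_left_cancel₀ hne ?_
        linear_combination q n * hr i - r n * hq i -
          ((i : ℂ) + 2) * (i + 1 + 2 * m') * h2
  exact key (n + 1) i (by omega)

/-! ### From the configuration of lines to the equilibrium -/

lemma norm_zCoord (a : ℝ) : ‖zCoord a‖ = 1 := by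
  rw [zCoord, show 2 * Complex.I * (a : ℂ) = ((2 * a : ℝ) : ℂ) * Complex.I by push_cast; ring]
  exact Complex.norm_exp_ofReal_mul_I _

lemma norm_zCoord_sub (a b : ℝ) : ‖zCoord a - zCoord b‖ = 2 * |Real.sin (a - b)| := by
  have h : zCoord a - zCoord b =
      zCoord b * (Complex.exp (Complex.I * ((2 * (a - b) : ℝ) : ℂ)) - 1) := by
    rw [mul_sub, zCoord, zCoord, ← Complex.exp_add, mul_one]
    congr 2; push_cast; ring
  rw [h, norm_mul, norm_zCoord, one_mul, Complex.norm_exp_I_mul_ofReal_sub_one, norm_mul,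
    mul_div_cancel_left₀ _ two_ne_zero]
  simp

lemma zCoord_eq_iff (a b : ℝ) : zCoord a = zCoord b ↔ Real.sin (a - b) = 0 := by
  rw [← sub_eq_zero, ← norm_eq_zero, norm_zCoord_sub]
  simp

lemma zCoord_zero : zCoord 0 = 1 := by simp [zCoord]

lemma zCoord_neg (a : ℝ) : zCoord (-a) = (zCoord a)⁻¹ := by
  rw [zCoord, zCoord, ← Complex.exp_neg]; congr 1; push_cast; ring

lemma zCoord_eq_neg_one {a : ℝ} (h : Real.cos a = 0) : zCoord a = -1 := by
  have := cos_mul_exp a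
  rw [h] at this
  simp only [Complex.ofReal_zero, mul_zero, zero_mul] at this
  linear_combination -this

lemma sin_sub_ne_zero_of_linearIndependent {a b : ℝ}
    (h : LinearIndependent ℝ ![dirVec a, dirVec b]) : Real.sin (a - b) ≠ 0 := by
  intro hs
  rw [Real.sin_sub] at hs
  rw [LinearIndependent.pair_iff] at h
  -- Both this combination and the next one vanish when `sin (a - b) = 0`; together they would force
  -- `sin b = cos b = 0`.
  have h1 := h (Real.sin b) (-Real.sin a) (by
    ext i; fin_cases i
    · simp [dirVec]; linarith
    · simp [dirVec]; ring)
  have h2 := h (Real.cos b) (-Real.cos a) (by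
    ext i; fin_cases i
    · simp [dirVec]; ring
    · simp [dirVec]; linarith)
  have := Real.sin_sq_add_cos_sq b
  rw [h1.1, h2.1] at this
  norm_num at this

lemma inner_dirVec (a b : ℝ) : inner ℝ (dirVec a) (dirVec b) = Real.cos (a - b) := by
  rw [Real.cos_sub]
  simp [dirVec, PiLp.inner_apply, Fin.sum_univ_two]
  ring

lemma norm_dirVec (a : ℝ) : ‖dirVec a‖ = 1 := by
  have h : ‖dirVec a‖ ^ 2 = 1 := by
    rw [← real_inner_self_eq_norm_sq, inner_dirVec, sub_self, Real.cos_zero]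
  exact (pow_eq_one_iff_of_nonneg (norm_nonneg _) two_ne_zero).1 h

/-- The mirror is the first coordinate axis, so the symmetry of the arrangement becomes closure of
the `z_i` under inversion. -/
lemma reflection_dirVec {a : ℝ} (ha : Real.sin a = 0) (b : ℝ) :
    (Submodule.span ℝ {dirVec a}).reflection (dirVec b) = dirVec (-b) := by
  have hc : Real.cos a * Real.cos a = 1 := by
    have := Real.sin_sq_add_cos_sq a
    rw [ha] at this; linarith
  rw [Submodule.reflection_singleton_apply, inner_dirVec, norm_dirVec, Real.cos_sub, ha]
  ext i; fin_cases i
  · simp [dirVec, ha]; linear_combination (2 * Real.cos b) * hc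
  · simp [dirVec, ha]

lemma sin_sub_eq_zero_of_span_eq {a b : ℝ}
    (h : Submodule.span ℝ {dirVec a} = Submodule.span ℝ {dirVec b}) : Real.sin (a - b) = 0 := by
  have : dirVec a ∈ Submodule.span ℝ {dirVec b} := h ▸ Submodule.mem_span_singleton_self _
  obtain ⟨t, ht⟩ := Submodule.mem_span_singleton.1 this
  have h0 := congr_arg (fun v : EuclideanSpace ℝ (Fin 2) => v 0) ht
  have h1 := congr_arg (fun v : EuclideanSpace ℝ (Fin 2) => v 1) ht
  simp [dirVec] at h0 h1
  rw [Real.sin_sub, ← h0, ← h1]; ring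

lemma IsConfiguration.isEquilibrium {m m' n : ℕ} {φ : Fin (n + 2) → ℝ}
    (h : IsConfiguration m m' n φ) (hz : zCoord (φ 0) = 1) :
    IsEquilibrium m m' n fun i => zCoord (φ i) := by
  have h0 : Real.sin (φ 0) = 0 := by
    rw [← zCoord_zero, zCoord_eq_iff, sub_zero] at hz; exact hz
  refine ⟨fun i j hij => ?_, fun i => zCoord_ne_zero _, hz, zCoord_eq_neg_one ?_, fun i => ?_,
    h.critical⟩
  · by_contra hne
    exact sin_sub_ne_zero_of_linearIndependent (h.noncollinear i j hne) ((zCoord_eq_iff _ _).1 hij)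
  · have ho := h.orthogonal
    rw [inner_dirVec, Real.cos_sub, h0, zero_mul, add_zero, mul_eq_zero] at ho
    refine ho.resolve_left fun hc => ?_
    have := Real.sin_sq_add_cos_sq (φ 0)
    rw [h0, hc] at this
    norm_num at this
  · obtain ⟨j, hj⟩ := h.symmetric i
    rw [reflection_dirVec h0] at hj
    exact ⟨j, by rw [← zCoord_neg, ((zCoord_eq_iff _ _).2 (sin_sub_eq_zero_of_span_eq hj))]⟩

/-! ### Comparison of `Q` with the Wronskian and the constant `ν` -/

lemma Q_eq_laurentFun (n : ℕ) (φ : Fin (n + 2) → ℝ) (θ : ℝ) :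
    Q n φ θ = laurentFun n (rootPoly fun i => zCoord (φ i)) θ := by
  rw [Q, laurentFun, eval_rootPoly]

/-- The leading coefficient of the `j`-th diagonal entry of the triangularised Wronskian. -/
def ladderLead (m m' n j : ℕ) : ℝ :=
  (-1) ^ (j - 1) * 2 ^ (param m m' n j - 1) *
    ∏ q ∈ Finset.Ico 1 j, ((param m m' n j : ℝ) - param m m' n q)

lemma ladder_coeff_param {m m' n j i : ℕ} (hj : j < m)
    (hi : i + (j + 1) + (j + 1 - (m - m')) = param m m' n (j + 1)) :
    (ladder (param m m' n (j + 1)) (m - m') (j + 1)).coeff i = ladderLead m m' n (j + 1) := by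
  rw [ladder_coeff_top (by omega) j i hi, ladderLead, Nat.add_sub_cancel]
  congr 1
  refine Finset.prod_congr rfl fun q hq => ?_
  rw [param_of_lt (j := q) (by rw [Finset.mem_Ico] at hq; omega)]

lemma ladderFun_param_of_lt {m m' n j : ℕ} (hj : j + 1 < m) (θ : ℝ) :
    ladderFun (param m m' n (j + 1)) (m - m') (j + 1) θ =
      Real.sin θ ^ (j + 1) * Real.cos θ ^ (j + 1 - (m - m')) * ladderLead m m' n (j + 1) := by
  have hp := param_of_lt (m' := m') (n := n) hj
  rw [ladderFun, ladder_eq_C hp.symm, eval_C, ladder_coeff_param (by omega) (by omega)]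

lemma ladderFun_param_self {m m' n : ℕ} {ζ : Fin (n + 2) → ℂ} (h : IsEquilibrium m m' n ζ)
    (hm : 1 ≤ m) (hmm : m' ≤ m) (θ : ℝ) :
    (2 ^ n * ladderFun (param m m' n m) (m - m') m θ : ℂ) =
      Real.sin θ ^ m * Real.cos θ ^ (m - (m - m')) * ladderLead m m' n m *
        laurentFun n (rootPoly ζ) θ := by
  have hb : m - (m - m') = m' := by omega
  have hk := param_self m m' n
  set R := ladder (param m m' n m) (m - m') m with hR
  have htop : R.coeff n = ladderLead m m' n m := by
    obtain ⟨j, rfl⟩ : ∃ j, m = j + 1 := ⟨m - 1, by omega⟩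
    exact ladder_coeff_param (by omega) (by omega)
  have hprop := proportional_of_recurrence (m := m) (m' := m') (n := n)
    (r := fun i => (R.coeff i : ℂ)) (q := (cosPoly ζ).coeff)
    (fun i => by
      have h1 := ladder_coeff_recurrence (param m m' n m) (m - m') m i
      rw [hb, hk, ← hk, ← hR, hk] at h1
      exact_mod_cast h1)
    h.cosPoly_coeff_recurrence
    (fun i hi => by rw [hR, ladder_coeff_of_lt _ _ _ _ (by omega), Complex.ofReal_zero])
    (fun i hi => coeff_cosPoly_of_lt ζ hi)
  -- The proportionality constant is read off at index `n`, where `cosPoly ζ` has coefficient `2^n`.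
  have hpoly : C (2 ^ n : ℂ) * R.map Complex.ofRealHom =
      C (ladderLead m m' n m : ℂ) * cosPoly ζ := by
    ext i
    rw [coeff_C_mul, coeff_C_mul, coeff_map, ← htop, ← h.coeff_cosPoly_self]
    exact hprop i
  have hev := congr_arg (eval (Real.cos θ : ℂ)) hpoly
  rw [eval_mul, eval_mul, eval_C, eval_C, h.eval_cosPoly] at hev
  have hmap : eval (Real.cos θ : ℂ) (R.map Complex.ofRealHom) = ((R.eval (Real.cos θ) : ℝ) : ℂ) :=
    eval_map_apply Complex.ofRealHom (Real.cos θ)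
  rw [hmap] at hev
  rw [ladderFun, ← hR]
  push_cast at hev ⊢
  linear_combination (Complex.sin θ ^ m * Complex.cos θ ^ (m - (m - m'))) * hev

lemma sum_range_add_one_sub (s m' : ℕ) :
    ∑ j ∈ Finset.range (s + m'), (j + 1 - s) = m' * (m' + 1) / 2 := by
  have : ∑ j ∈ Finset.range (s + m'), (j + 1 - s) = ∑ j ∈ Finset.range (m' + 1), j := by
    induction m' with
    | zero =>
      rw [add_zero, Finset.sum_eq_zero fun j hj => by rw [Finset.mem_range] at hj; omega]
      simp
    | succ k ih => rw [← add_assoc, Finset.sum_range_succ, ih, Finset.sum_range_succ _ (k + 1)]; omega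
  rw [this, Finset.sum_range_id, Nat.add_sub_cancel, mul_comm]

lemma sum_range_param_sub_one {m m' n : ℕ} (hm : 1 ≤ m) (hmm : m' ≤ m) :
    ∑ j ∈ Finset.range m, (param m m' n (j + 1) - 1) =
      m' * (m' + 1) / 2 + m * (m - 1) / 2 + n := by
  have h1 : ∑ j ∈ Finset.range m, (j + (j + 1 - (m - m')) + if j + 1 = m then n else 0) =
      ∑ j ∈ Finset.range m, (param m m' n (j + 1) - 1) := by
    refine Finset.sum_congr rfl fun j hj => ?_
    rw [Finset.mem_range] at hj
    split_ifs with h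
    · rw [h, param_self]; omega
    · rw [param_of_lt (by omega)]; omega
  have h2 := sum_range_add_one_sub (m - m') m'
  rw [Nat.sub_add_cancel hmm] at h2
  have h3 : ∑ j ∈ Finset.range m, (if j + 1 = m then n else 0) = n := by
    rw [Finset.sum_eq_single_of_mem (m - 1) (by simp; omega) fun j _ hj => if_neg (by omega),
      if_pos (by omega)]
  rw [← h1, Finset.sum_add_distrib, Finset.sum_add_distrib, h2, h3, Finset.sum_range_id]
  ring

lemma prod_Icc_one_eq {M : Type*} [CommMonoid M] (f : ℕ → M) (m : ℕ) :
    ∏ p ∈ Finset.Icc 1 m, f p = ∏ j ∈ Finset.range m, f (j + 1) := by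
  rw [← Finset.Ico_succ_right_eq_Icc, Finset.prod_Ico_eq_prod_range]
  exact Finset.prod_congr rfl fun j _ => by rw [add_comm]

lemma param_lt_param {m m' n p q : ℕ} (hq1 : 1 ≤ q) (hq : q < p) (hp : p ≤ m) :
    param m m' n q < param m m' n p := by
  rw [param_of_lt (by omega : q < m)]
  rcases hp.lt_or_eq with h | rfl
  · rw [param_of_lt h]; omega
  · rw [param_self]; omega

lemma prod_param_sub_ne_zero (m m' n : ℕ) :
    ∏ p ∈ Finset.Icc 1 m, ∏ q ∈ Finset.Ico 1 p,
      ((param m m' n p : ℝ) - (param m m' n q : ℝ)) ≠ 0 := by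
  refine Finset.prod_ne_zero_iff.2 fun p hp => Finset.prod_ne_zero_iff.2 fun q hq => ?_
  rw [Finset.mem_Icc] at hp
  rw [Finset.mem_Ico] at hq
  rw [sub_ne_zero]
  exact_mod_cast (param_lt_param hq.1 hq.2 hp.2).ne'

/-- `ν` inverts the product of the leading coefficients up to `2^n`, the top coefficient of `q`. -/
lemma nu_mul_prod_ladderLead {m m' n : ℕ} (hm : 1 ≤ m) (hmm : m' ≤ m) :
    nu m m' n * ∏ j ∈ Finset.range m, ladderLead m m' n (j + 1) = 2 ^ n := by
  have h1 : ∏ j ∈ Finset.range m, ladderLead m m' n (j + 1) =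
      (-1) ^ (m * (m - 1) / 2) * 2 ^ (m' * (m' + 1) / 2 + m * (m - 1) / 2 + n) *
        ∏ p ∈ Finset.Icc 1 m, ∏ q ∈ Finset.Ico 1 p,
          ((param m m' n p : ℝ) - (param m m' n q : ℝ)) := by
    rw [prod_Icc_one_eq, ← sum_range_param_sub_one hm hmm, ← Finset.sum_range_id,
      ← Finset.prod_pow_eq_pow_sum, ← Finset.prod_pow_eq_pow_sum, ← Finset.prod_mul_distrib,
      ← Finset.prod_mul_distrib]
    rfl
  have h2 := prod_param_sub_ne_zero m m' n
  rw [h1, nu]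
  simp only [Finset.prod_inv_distrib]
  generalize (∏ p ∈ Finset.Icc 1 m, ∏ q ∈ Finset.Ico 1 p,
    ((param m m' n p : ℝ) - (param m m' n q : ℝ))) = V at *
  rw [pow_add _ _ n, inv_pow]
  have h3 : ((-1 : ℝ) ^ (m * (m - 1) / 2)) * (-1) ^ (m * (m - 1) / 2) = 1 := by
    rw [← mul_pow]; simp
  field_simp
  linear_combination h3

lemma sin_pow_mul_cos_pow_mul_Q {m m' n : ℕ} {φ : Fin (n + 2) → ℝ}
    (h : IsEquilibrium m m' n fun i => zCoord (φ i)) (hm : 1 ≤ m) (hmm : m' ≤ m) {θ : ℝ}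
    (hs : Real.sin θ ≠ 0) (hc : m' ≠ 0 → Real.cos θ ≠ 0) :
    ((Real.sin θ ^ (m * (m + 1) / 2) * Real.cos θ ^ (m' * (m' + 1) / 2) : ℝ) : ℂ) * Q n φ θ =
      ((nu m m' n * wronskian (chi m m' n) θ : ℝ) : ℂ) := by
  have hA : ∑ j ∈ Finset.range m, (j + 1) = m * (m + 1) / 2 := by
    have h1 := Finset.sum_range_id (m + 1)
    rw [Finset.sum_range_succ', add_zero, Nat.add_sub_cancel] at h1
    rw [h1, mul_comm]
  have hB := sum_range_add_one_sub (m - m') m'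
  rw [Nat.sub_add_cancel hmm] at hB
  have hprod : ((∏ j ∈ Finset.range m, (Real.sin θ ^ (j + 1) * Real.cos θ ^ (j + 1 - (m - m')) *
      ladderLead m m' n (j + 1)) : ℝ) : ℂ) * Q n φ θ =
      2 ^ n * (wronskian (chi m m' n) θ : ℂ) := by
    rw [wronskian_chi_eq_prod hmm h.even hs hc, Q_eq_laurentFun]
    have hlast := ladderFun_param_self h hm hmm θ
    obtain ⟨μ, rfl⟩ : ∃ μ, m = μ + 1 := ⟨m - 1, by omega⟩
    rw [Finset.prod_range_succ, Finset.prod_range_succ, Finset.prod_congr rfl fun j hj =>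
      ladderFun_param_of_lt (m := μ + 1) (by rw [Finset.mem_range] at hj; omega) θ]
    rw [Complex.ofReal_mul, Complex.ofReal_mul]
    generalize ∏ j ∈ Finset.range μ, (Real.sin θ ^ (j + 1) * Real.cos θ ^ (j + 1 - (μ + 1 - m')) *
      ladderLead (μ + 1) m' n (j + 1)) = V
    push_cast at hlast ⊢
    linear_combination -(V : ℂ) * hlast
  rw [Finset.prod_mul_distrib, Finset.prod_mul_distrib, Finset.prod_pow_eq_pow_sum,
    Finset.prod_pow_eq_pow_sum, hA, hB] at hprod
  have hν := congr_arg Complex.ofReal (nu_mul_prod_ladderLead (n := n) hm hmm)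
  rw [Complex.ofReal_mul] at hν hprod
  rw [Complex.ofReal_pow, Complex.ofReal_ofNat] at hν
  refine mul_left_cancel₀ (pow_ne_zero n (two_ne_zero' ℂ)) ?_
  rw [Complex.ofReal_mul (nu m m' n)]
  linear_combination (nu m m' n : ℂ) * hprod -
    ((Real.sin θ ^ (m * (m + 1) / 2) * Real.cos θ ^ (m' * (m' + 1) / 2) : ℝ) : ℂ) * Q n φ θ * hν

lemma Q_eq_nu_mul_wronskian {m m' n : ℕ} {φ : Fin (n + 2) → ℝ}
    (h : IsEquilibrium m m' n fun i => zCoord (φ i)) (hm : 1 ≤ m) (hmm : m' ≤ m) {θ : ℝ}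
    (hs : Real.sin θ ≠ 0) (hc : m' ≠ 0 → Real.cos θ ≠ 0) :
    Q n φ θ = ((nu m m' n * (Real.cos θ ^ (m' * (m' + 1) / 2))⁻¹ *
      (Real.sin θ ^ (m * (m + 1) / 2))⁻¹ * wronskian (chi m m' n) θ : ℝ) : ℂ) := by
  have h1 := sin_pow_mul_cos_pow_mul_Q h hm hmm hs hc
  have hs' : Real.sin θ ^ (m * (m + 1) / 2) ≠ 0 := pow_ne_zero _ hs
  have hc' : Real.cos θ ^ (m' * (m' + 1) / 2) ≠ 0 := by
    rcases eq_or_ne m' 0 with rfl | h0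
    · simp
    · exact pow_ne_zero _ (hc h0)
  have h2 : ((Real.sin θ ^ (m * (m + 1) / 2) * Real.cos θ ^ (m' * (m' + 1) / 2) : ℝ) : ℂ) ≠ 0 :=
    Complex.ofReal_ne_zero.2 (mul_ne_zero hs' hc')
  refine mul_left_cancel₀ h2 (h1.trans ?_)
  rw [← Complex.ofReal_mul]
  congr 1
  field_simp

/-! ### Nonvanishing of the Wronskian and the potential -/

lemma norm_Q (n : ℕ) (φ : Fin (n + 2) → ℝ) (θ : ℝ) :
    ‖Q n φ θ‖ = ∏ j : Fin n, 2 * |Real.sin (θ - φ (inner1 j))| := by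
  have h : ‖Complex.exp (-(Complex.I * (n : ℂ) * (θ : ℂ)))‖ = 1 := by
    rw [show -(Complex.I * (n : ℂ) * (θ : ℂ)) = ((-(n * θ) : ℝ) : ℂ) * Complex.I by
      push_cast; ring]
    exact Complex.norm_exp_ofReal_mul_I _
  rw [Q, norm_mul, h, mul_one, norm_prod]
  exact Finset.prod_congr rfl fun j _ => norm_zCoord_sub _ _

lemma isOpen_regularSet {m m' n : ℕ} (φ : Fin (n + 2) → ℝ) : IsOpen (regularSet m m' n φ) := by
  have hne (f : ℝ → ℝ) (hf : Continuous f) (k : ℕ) : IsOpen {θ | k ≠ 0 → f θ ≠ 0} := by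
    by_cases hk : k = 0
    · simp [hk]
    · simpa [hk] using isOpen_ne_fun hf (continuous_const (y := (0 : ℝ)))
  have h3 : IsOpen {θ | ∀ j : Fin n, Real.sin (θ - φ (inner1 j)) ≠ 0} := by
    rw [Set.ofPred_forall]
    exact isOpen_iInter_of_finite fun j => isOpen_ne_fun (by fun_prop) continuous_const
  exact (hne _ Real.continuous_sin m).inter ((hne _ Real.continuous_cos m').inter h3)

section Potential

variable {m m' n : ℕ} {φ : Fin (n + 2) → ℝ}

lemma wronskian_chi_ne_zero (h : IsEquilibrium m m' n fun i => zCoord (φ i)) (hm : 1 ≤ m)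
    (hmm : m' ≤ m) {θ : ℝ} (hθ : θ ∈ regularSet m m' n φ) : wronskian (chi m m' n) θ ≠ 0 := by
  intro h0
  have h1 := Q_eq_nu_mul_wronskian h hm hmm (hθ.1 (by omega)) hθ.2.1
  rw [h0, mul_zero, Complex.ofReal_zero, ← norm_eq_zero, norm_Q, Finset.prod_eq_zero_iff] at h1
  obtain ⟨j, _, hj⟩ := h1
  exact hθ.2.2 j (by simpa using hj)

lemma nu_ne_zero : nu m m' n ≠ 0 := by
  have := prod_param_sub_ne_zero m m' n
  rw [nu]
  simp only [Finset.prod_inv_distrib]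
  exact mul_ne_zero (mul_ne_zero (by positivity) (pow_ne_zero _ (by norm_num))) (inv_ne_zero this)

/-- Logarithm of the absolute values in the formula for `Q`; `Real.log` ignores signs, so no choice
of branch intervenes. -/
lemma log_wronskian_chi (h : IsEquilibrium m m' n fun i => zCoord (φ i)) (hm : 1 ≤ m)
    (hmm : m' ≤ m) {θ : ℝ} (hθ : θ ∈ regularSet m m' n φ) :
    Real.log (wronskian (chi m m' n) θ) =
      (m * (m + 1) / 2 : ℕ) * Real.log (Real.sin θ) +
      (m' * (m' + 1) / 2 : ℕ) * Real.log (Real.cos θ) +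
      ∑ j : Fin n, Real.log (Real.sin (θ - φ (inner1 j))) +
      (n * Real.log 2 - Real.log (nu m m' n)) := by
  have hs := hθ.1 (by omega : m ≠ 0)
  have hs' : Real.sin θ ^ (m * (m + 1) / 2) ≠ 0 := pow_ne_zero _ hs
  have hc' : Real.cos θ ^ (m' * (m' + 1) / 2) ≠ 0 := by
    rcases eq_or_ne m' 0 with rfl | h0
    · simp
    · exact pow_ne_zero _ (hθ.2.1 h0)
  have hW := wronskian_chi_ne_zero h hm hmm hθ
  have h1 := congr_arg norm (Q_eq_nu_mul_wronskian h hm hmm hs hθ.2.1)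
  rw [norm_Q, Complex.norm_real, Real.norm_eq_abs] at h1
  have h2 := congr_arg Real.log h1
  rw [Real.log_abs, Real.log_mul (by simp [nu_ne_zero, hs', hc']) hW,
    Real.log_mul (by simp [nu_ne_zero, hc']) (inv_ne_zero hs'),
    Real.log_mul nu_ne_zero (inv_ne_zero hc'), Real.log_inv, Real.log_inv, Real.log_pow,
    Real.log_pow, Real.log_prod fun j _ => by simpa using hθ.2.2 j,
    Finset.sum_congr rfl fun j _ => by
      rw [Real.log_mul two_ne_zero (by simpa using hθ.2.2 j), Real.log_abs],
    Finset.sum_add_distrib, Finset.sum_const, Finset.card_univ, Fintype.card_fin,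
    nsmul_eq_mul] at h2
  linear_combination -h2

lemma hasDerivAt_log_sin {θ : ℝ} (a : ℝ) (h : Real.sin (θ - a) ≠ 0) :
    HasDerivAt (fun t => Real.log (Real.sin (t - a))) (Real.cos (θ - a) / Real.sin (θ - a)) θ :=
  ((Real.hasDerivAt_sin _).comp_sub_const θ a).log h

lemma hasDerivAt_cot {θ : ℝ} (a : ℝ) (h : Real.sin (θ - a) ≠ 0) :
    HasDerivAt (fun t => Real.cos (t - a) / Real.sin (t - a)) (-(1 / Real.sin (θ - a) ^ 2)) θ := by
  refine (((Real.hasDerivAt_cos _).comp_sub_const θ a).div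
    ((Real.hasDerivAt_sin _).comp_sub_const θ a) h).congr_deriv ?_
  rw [← neg_div]
  congr 1
  linear_combination -Real.sin_sq_add_cos_sq (θ - a)

lemma deriv_deriv_log_wronskian_chi (h : IsEquilibrium m m' n fun i => zCoord (φ i)) (hm : 1 ≤ m)
    (hmm : m' ≤ m) {θ : ℝ} (hθ : θ ∈ regularSet m m' n φ) :
    -2 * deriv (deriv fun t => Real.log (wronskian (chi m m' n) t)) θ =
      angularPotential m m' n φ θ := by
  set A : ℝ := ((m * (m + 1) / 2 : ℕ) : ℝ) with hA
  set B : ℝ := ((m' * (m' + 1) / 2 : ℕ) : ℝ) with hB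
  have two_mul_tri (k : ℕ) : 2 * ((k * (k + 1) / 2 : ℕ) : ℝ) = k * (k + 1) := by
    have := Nat.mul_div_cancel' (Nat.even_mul_succ_self k).two_dvd
    exact_mod_cast this
  have hopen := isOpen_regularSet (m := m) (m' := m') φ
  -- If `m' = 0` the regular set may contain zeros of the cosine, but then `B = 0`.
  have hcos (t : ℝ) (ht : t ∈ regularSet m m' n φ) :
      HasDerivAt (fun t => B * Real.log (Real.cos t)) (B * -(Real.sin t / Real.cos t)) t := by
    rcases eq_or_ne m' 0 with rfl | h0
    · simpa [hB] using hasDerivAt_const t (0 : ℝ)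
    · exact (((Real.hasDerivAt_cos t).log (ht.2.1 h0)).const_mul B).congr_deriv (by ring)
  have htan (t : ℝ) (ht : t ∈ regularSet m m' n φ) :
      HasDerivAt (fun t => B * -(Real.sin t / Real.cos t)) (B * -(1 / Real.cos t ^ 2)) t := by
    rcases eq_or_ne m' 0 with rfl | h0
    · simpa [hB] using hasDerivAt_const t (0 : ℝ)
    · refine ((((Real.hasDerivAt_sin t).div (Real.hasDerivAt_cos t)
        (ht.2.1 h0)).fun_neg).const_mul B).congr_deriv ?_
      congr 3
      linear_combination Real.sin_sq_add_cos_sq t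
  have hsin0 (t : ℝ) (ht : t ∈ regularSet m m' n φ) : Real.sin (t - 0) ≠ 0 := by
    rw [sub_zero]; exact ht.1 (by omega)
  have h1 : ∀ t ∈ regularSet m m' n φ, HasDerivAt (fun t => Real.log (wronskian (chi m m' n) t))
      (A * (Real.cos (t - 0) / Real.sin (t - 0)) + B * -(Real.sin t / Real.cos t) +
        ∑ j : Fin n, Real.cos (t - φ (inner1 j)) / Real.sin (t - φ (inner1 j))) t := by
    intro t ht
    have hd := ((((hasDerivAt_log_sin 0 (hsin0 t ht)).const_mul A).add (hcos t ht)).add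
      (HasDerivAt.fun_sum fun j (_ : j ∈ Finset.univ) =>
        hasDerivAt_log_sin (φ (inner1 j)) (ht.2.2 j))).add_const
          (n * Real.log 2 - Real.log (nu m m' n))
    refine hd.congr_of_eventuallyEq ?_
    filter_upwards [hopen.mem_nhds ht] with u hu
    rw [log_wronskian_chi h hm hmm hu]
    simp [hA, hB]
  have h2 := ((((hasDerivAt_cot 0 (hsin0 θ hθ)).const_mul A).add (htan θ hθ)).add
      (HasDerivAt.fun_sum fun j (_ : j ∈ Finset.univ) =>
        hasDerivAt_cot (φ (inner1 j)) (hθ.2.2 j)))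
  -- Openness of the regular set makes the first derivative formula valid near `θ`, so it may be
  -- differentiated again.
  have h3 := h2.congr_of_eventuallyEq (f₁ := deriv fun t => Real.log (wronskian (chi m m' n) t))
    (by filter_upwards [hopen.mem_nhds hθ] with u hu using (h1 u hu).deriv)
  rw [h3.deriv, angularPotential, ← two_mul_tri, ← two_mul_tri, sub_zero,
    Finset.sum_neg_distrib, show (fun j : Fin n => 2 / Real.sin (θ - φ (inner1 j)) ^ 2) =
      fun j => 2 * (1 / Real.sin (θ - φ (inner1 j)) ^ 2) from funext fun j => by ring,
    ← Finset.mul_sum]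
  ring

end Potential

end DarbouxCrum

end

theorem theorem4p1 (m m' n : ℕ) (hm : 1 ≤ m) (hmm' : m' ≤ m) (φ : Fin (n + 2) → ℝ)
    (hφ : DarbouxCrum.IsConfiguration m m' n φ) (hz : DarbouxCrum.zCoord (φ 0) = 1) :
    (∀ θ ∈ DarbouxCrum.regularSet m m' n φ,
      DarbouxCrum.wronskian (DarbouxCrum.chi m m' n) θ ≠ 0) ∧
    (∀ f : ℝ → ℂ, ∀ θ ∈ DarbouxCrum.regularSet m m' n φ,
      DarbouxCrum.sturmLiouville (DarbouxCrum.angularPotential m m' n φ) f θ =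
        DarbouxCrum.darbouxCrum (fun _ => 0) (DarbouxCrum.chi m m' n) f θ) ∧
    (∀ θ : ℝ, Real.sin θ ≠ 0 → (m' ≠ 0 → Real.cos θ ≠ 0) →
      DarbouxCrum.Q n φ θ =
        ((DarbouxCrum.nu m m' n * (Real.cos θ ^ (m' * (m' + 1) / 2))⁻¹ *
          (Real.sin θ ^ (m * (m + 1) / 2))⁻¹ *
          DarbouxCrum.wronskian (DarbouxCrum.chi m m' n) θ : ℝ) : ℂ)) := by
  have h := hφ.isEquilibrium hz
  refine ⟨fun θ hθ => DarbouxCrum.wronskian_chi_ne_zero h hm hmm' hθ, fun f θ hθ => ?_,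
    fun θ hs hc => DarbouxCrum.Q_eq_nu_mul_wronskian h hm hmm' hs hc⟩
  rw [DarbouxCrum.darbouxCrum, DarbouxCrum.sturmLiouville, DarbouxCrum.sturmLiouville,
    ← DarbouxCrum.deriv_deriv_log_wronskian_chi h hm hmm' hθ, zero_sub, neg_mul]
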